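/- Work in the complex projective plane. A \emph{polycon} $\mathcal P$ consists of $n\ge 2$ reduced curves $C_1,\dots,C_n\subset\mathbb P^2$ of degree one or two (boundary components, cyclically indexed) and distinct points $v_{i,i+1}$ (explicit vertices) such that $C_i$ and $C_{i+1}$ meet transversally in $v_{i,i+1}$ and no other $C_j$ contains $v_{i,i+1}$. The singular point of a singular conic $C_i$ is called an implicit vertex; it is required to lie on no other $C_j$, and $v_{i-1,i},v_{i,i+1}$ are required to lie on different lines of such a $C_i$. Let $C_{\mathcal P}=V(\prod_i c_i)$ with $C_i=V(c_i)$, $d=\sum_i\deg C_i$, and let the residual arrangement $R(\mathcal P)$ be the set of singular points of $C_{\mathcal P}$ that are not (explicit or implicit) vertices. $\mathcal P$ is \emph{nodal} if all singularities of $C_{\mathcal P}$ are nodes. An \emph{adjoint curve} of $\mathcal P$ is the zero locus of a nonzero form of degree $d-3$ whose germ at every point of $R(\mathcal P)$ lies in the conductor of the normalization of $C_{\mathcal P}$ there (for nodal $\mathcal P$: which vanishes on $R(\mathcal P)$). For a curve $A$, $H$ denotes the hyperplane class on $A$. \textbf{Statement.} Let $\mathcal P$ be a nodal polycon of degree $d\ge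 4$ with adjoint curve $A$ (of degree $d-3$). Let $C_i$ be a boundary component of degree two, let $L$ be the line through $v_{i-1,i}$ and $v_{i,i+1}$, let $\mathcal P'$ be obtained from $\mathcal P$ by replacing $C_i$ with $L$ (keeping the explicit vertices), and let $D=R(\mathcal P)\cap R(\mathcal P')$, regarded as a sum of points. Then: 1. $D$ is a finite sum of regular points of $A$, hence a divisor on $A$; if $\mathcal P'$ is again a polycon and $A'$ is its adjoint curve, then $A'.A=2D$, i.e. $D$ is the contact divisor of $A'$ on $A$. 2. $2D\sim(d-4)H$ on $A$ and $h^0(A,\mathcal O_A(D-H))=0$. 3. $D$ satisfies the hypotheses of Dixon's algorithm for (possibly singular) plane curves: $D$ is supported in the regular locus of $A$, $2D$ is the intersection divisor of $A$ with some curve of degree $\deg A-1=d-4$, and $h^0(A,\mathcal O_A(D-H))=0$. Moreover, for every nodal polycon $\mathcal P$ of degree $d\ge 4$ with adjoint curve $A$, the set $R(\mathcal P)$ is a finite set of regular points of $A$, and the divisor $T=R(\mathcal P)-3H$ on $A$ satisfies $2T\sim(d-6)H$ (that is, $2T\sim(\deg A-3)H$) and $h^0(A,\mathcal O_A(T))=0$.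 -/

import Mathlib

open scoped LinearAlgebra.Projectivization

noncomputable section

namespace PlaneCurve

/-! Projective plane curves over `ℂ`, given by homogeneous polynomials in three variables. -/

/-- The homogeneous coordinate ring `ℂ[x₀, x₁, x₂]` of the projective plane. -/
abbrev Poly : Type := MvPolynomial (Fin 3) ℂ

/-- The (closed) points of the complex projective plane. -/
abbrev Pt : Type := ℙ ℂ (Fin 3 → ℂ)

/-- `F` vanishes at `p`. (For homogeneous `F` this is independent of the representative.) -/
def VanishesAt (F : Poly) (p : Pt) : Prop := MvPolynomial.eval p.rep F = 0

/-- The gradient of `F` at (a representative of) `p`. -/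
def grad (F : Poly) (p : Pt) : Fin 3 → ℂ :=
  fun j => MvPolynomial.eval p.rep (MvPolynomial.pderiv j F)

/-- The Hessian matrix of `F` at (a representative of) `p`. -/
def hessian (F : Poly) (p : Pt) : Matrix (Fin 3) (Fin 3) ℂ :=
  Matrix.of fun j k => MvPolynomial.eval p.rep (MvPolynomial.pderiv j (MvPolynomial.pderiv k F))

/-- `p` is a smooth (regular) point of the curve `F = 0`. -/
def IsSmoothPt (F : Poly) (p : Pt) : Prop := VanishesAt F p ∧ grad F p ≠ 0

/-- The singular points of the curve `F = 0`. -/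
def singularSet (F : Poly) : Set Pt := {p | VanishesAt F p ∧ grad F p = 0}

/-- `p` is a node (ordinary double point) of `F = 0`: it is singular and the quadratic tangent cone
consists of two distinct lines. The Hessian of a homogeneous `F` at a singular point `p` has `p` in
its kernel and induces the quadratic part of a local equation, so this says that its rank is `2`. -/
def IsNode (F : Poly) (p : Pt) : Prop := p ∈ singularSet F ∧ (hessian F p).rank = 2

/-- `F = 0` and `G = 0` both pass through `p`, are smooth there and have different tangents. -/
def TransversalAt (F G : Poly) (p : Pt) : Prop :=
  VanishesAt F p ∧ VanishesAt G p ∧ LinearIndependent ℂ ![grad F p, grad G p]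

/-! ### Local rings and intersection multiplicities -/

/-- The homogeneous prime ideal of `p`: all polynomials that vanish on the line `ℂ · p`. -/
def ptIdeal (p : Pt) : Ideal Poly :=
  RingHom.ker (MvPolynomial.aeval
    (fun j : Fin 3 => Polynomial.C (p.rep j) * (Polynomial.X : Polynomial ℂ)) :
      Poly →ₐ[ℂ] Polynomial ℂ)

instance ptIdeal_isPrime (p : Pt) : (ptIdeal p).IsPrime := RingHom.ker_isPrime _

/-- The grading of the homogeneous coordinate ring by degree. -/
instance polyGrading : GradedAlgebra (MvPolynomial.homogeneousSubmodule (Fin 3) ℂ) :=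
  MvPolynomial.gradedAlgebra

/-- The local ring `𝒪_{ℙ², p}`: degree zero fractions with denominator not vanishing at `p`. -/
abbrev LocalRingAt (p : Pt) : Type :=
  HomogeneousLocalization.AtPrime (MvPolynomial.homogeneousSubmodule (Fin 3) ℂ) (ptIdeal p)

/-- The stalk at `p` of the ideal sheaf of a homogeneous ideal `I`: the elements `a / w` of
`𝒪_{ℙ², p}` with `a ∈ I`. -/
def stalkIdeal (I : Ideal Poly) (p : Pt) : Ideal (LocalRingAt p) :=
  (I.map (algebraMap Poly (Localization.AtPrime (ptIdeal p)))).comap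
    (algebraMap (LocalRingAt p) (Localization.AtPrime (ptIdeal p)))

/-- The intersection multiplicity at `p` of `F = 0` and `G = 0`: the length of
`𝒪_{ℙ², p} / (F, G)`; it is `⊤` if the curves share a component through `p`. -/
def intMult (F G : Poly) (p : Pt) : ℕ∞ :=
  Module.length (LocalRingAt p) (LocalRingAt p ⧸ stalkIdeal (Ideal.span {F, G}) p)

/-- The local ring at `p` of the plane curve `F = 0`. -/
abbrev CurveLocalRing (F : Poly) (p : Pt) : Type :=
  LocalRingAt p ⧸ stalkIdeal (Ideal.span {F}) p

/-- The conductor of a (reduced) ring `R` in its normalization, the integral closure of `R` in its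
total ring of fractions `K`: all `a ∈ R` with `a z ∈ R` for every `z ∈ K` integral over `R`. -/
def conductorIdeal (R : Type*) [CommRing R] : Ideal R where
  carrier := {a | ∀ z : FractionRing R, IsIntegral R z →
    ∃ r : R, algebraMap R (FractionRing R) r = algebraMap R (FractionRing R) a * z}
  zero_mem' := fun z _ => ⟨0, by simp⟩
  add_mem' := by
    intro a b ha hb z hz
    obtain ⟨r, hr⟩ := ha z hz
    obtain ⟨s, hs⟩ := hb z hz
    exact ⟨r + s, by rw [map_add, map_add, hr, hs, add_mul]⟩
  smul_mem' := by
    intro c a ha z hz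
    obtain ⟨r, hr⟩ := ha z hz
    exact ⟨c * r, by rw [smul_eq_mul, map_mul, map_mul, hr, mul_assoc]⟩

/-- At `p`, the form `G` is a (twisted) germ of the conductor of the normalization of the plane
curve `F = 0` at `p`. -/
def InConductorAt (F G : Poly) (p : Pt) : Prop :=
  (stalkIdeal (Ideal.span {G}) p).map (Ideal.Quotient.mk (stalkIdeal (Ideal.span {F}) p)) ≤
    conductorIdeal (CurveLocalRing F p)

/-! ### Divisors supported in the regular locus, twisted by multiples of the hyperplane class -/

/-- A pair `(E, m)` stands for the divisor `E + m H` on a plane curve, where `E` is a finite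
integral combination of points (regular points of the curve, see `SupportedInRegularLocus`) and `H`
is the hyperplane class; its associated sheaf is `𝒪(E) ⊗ 𝒪(m)`. -/
abbrev Divisor : Type := (Pt →₀ ℤ) × ℤ

/-- The hyperplane class. -/
def H : Divisor := (0, 1)

/-- The point part of the divisor consists of regular points of `F = 0`. -/
def SupportedInRegularLocus (F : Poly) (D : Divisor) : Prop :=
  ∀ p, D.1 p ≠ 0 → IsSmoothPt F p

/-- `D` is the sum of the points of `s`, each with coefficient one. -/
def IsPointSum (s : Set Pt) (D : Divisor) : Prop :=
  D.2 = 0 ∧ ∀ p, D.1 p = s.indicator 1 p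

/-- The total ring of fractions of the homogeneous coordinate ring `ℂ[x₀, x₁, x₂] / (F)`. -/
abbrev RatRing (F : Poly) : Type := FractionRing (Poly ⧸ Ideal.span {F})

/-- A polynomial, as an element of `RatRing F`. -/
def toRat (F : Poly) : Poly →+* RatRing F :=
  (algebraMap (Poly ⧸ Ideal.span {F}) (RatRing F)).comp (Ideal.Quotient.mk (Ideal.span {F}))

/-- `φ` is a rational section of `𝒪(m)` on `F = 0`: a fraction `g / h` of homogeneous elements with
`deg g = deg h + m`, whose denominator is not a zero divisor. -/
def IsRationalSection (F : Poly) (m : ℤ) (φ : RatRing F) : Prop :=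
  φ = 0 ∨ ∃ (a b : ℕ) (g h : Poly), g.IsHomogeneous a ∧ h.IsHomogeneous b ∧ (a : ℤ) = b + m ∧
    Ideal.Quotient.mk (Ideal.span {F}) h ∈ nonZeroDivisors (Poly ⧸ Ideal.span {F}) ∧
    φ * toRat F h = toRat F g

/-- The germ of `φ` at `p` lies in `𝔪_p ^ (-k)`: up to a factor `w` that is a unit at `p`,
multiplication by `𝔪_p ^ k` (if `k ≥ 0`) makes `φ` regular, and `φ` lies in `𝔪_p ^ (-k)`
(if `k ≤ 0`). -/
def PoleOrderLE (F : Poly) (p : Pt) (k : ℤ) (φ : RatRing F) : Prop :=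
  ∃ w : Poly, w ∉ ptIdeal p ∧ ∀ t ∈ ptIdeal p ^ k.toNat, ∃ u ∈ ptIdeal p ^ (-k).toNat,
    toRat F (w * t) * φ = toRat F u

theorem smul_eq_toRat (F : Poly) (c : ℂ) (φ : RatRing F) :
    c • φ = toRat F (MvPolynomial.C c) * φ := by
  rw [Algebra.smul_def]
  rfl

theorem IsRationalSection.add {F : Poly} {m : ℤ} {φ ψ : RatRing F}
    (h1 : IsRationalSection F m φ) (h2 : IsRationalSection F m ψ) :
    IsRationalSection F m (φ + ψ) := by
  rcases h1 with rfl | ⟨a, b, g, h, hg, hh, e, hn, q⟩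
  · simpa using h2
  rcases h2 with rfl | ⟨a', b', g', h', hg', hh', e', hn', q'⟩
  · rw [add_zero]
    exact Or.inr ⟨a, b, g, h, hg, hh, e, hn, q⟩
  refine Or.inr ⟨a + b', b + b', g * h' + g' * h, h * h', ?_, hh.mul hh', by push_cast; omega, ?_, ?_⟩
  · refine (hg.mul hh').add ?_
    have : a + b' = a' + b := by omega
    rw [this]
    exact hg'.mul hh
  · rw [map_mul]
    exact mul_mem hn hn'
  · rw [map_add, map_mul, map_mul, map_mul, ← q, ← q']
    ring

theorem PoleOrderLE.add {F : Poly} {p : Pt} {k : ℤ} {φ ψ : RatRing F}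
    (h1 : PoleOrderLE F p k φ) (h2 : PoleOrderLE F p k ψ) : PoleOrderLE F p k (φ + ψ) := by
  obtain ⟨w, hw, H1⟩ := h1
  obtain ⟨w', hw', H2⟩ := h2
  refine ⟨w * w', fun hc => ((ptIdeal_isPrime p).mem_or_mem hc).elim hw hw', fun t ht => ?_⟩
  obtain ⟨u, hu, e⟩ := H1 t ht
  obtain ⟨u', hu', e'⟩ := H2 t ht
  refine ⟨w' * u + w * u', add_mem (Ideal.mul_mem_left _ _ hu) (Ideal.mul_mem_left _ _ hu'), ?_⟩
  rw [map_add, map_mul _ w' u, map_mul _ w u', ← e, ← e']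
  simp only [map_mul]
  ring

/-- The space `H⁰(A, 𝒪_A(D))` of global sections of the sheaf associated with `D = E + m H` on the
curve `A : F = 0`: the rational sections of `𝒪(m)` with `div φ + E ≥ 0`. -/
def globalSections (F : Poly) (D : Divisor) : Submodule ℂ (RatRing F) where
  carrier := {φ | IsRationalSection F D.2 φ ∧ ∀ p, PoleOrderLE F p (D.1 p) φ}
  zero_mem' := ⟨Or.inl rfl, fun p =>
    ⟨1, (Ideal.ne_top_iff_one _).1 (ptIdeal_isPrime p).ne_top, fun _ _ => ⟨0, zero_mem _, by simp⟩⟩⟩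
  add_mem' := fun h1 h2 => ⟨h1.1.add h2.1, fun p => (h1.2 p).add (h2.2 p)⟩
  smul_mem' := by
    rintro c φ ⟨h1, h2⟩
    refine ⟨?_, fun p => ?_⟩
    · rcases h1 with rfl | ⟨a, b, g, h, hg, hh, e, hn, q⟩
      · exact Or.inl (smul_zero c)
      · refine Or.inr ⟨a, b, MvPolynomial.C c * g, h, ?_, hh, e, hn, ?_⟩
        · simpa using (MvPolynomial.isHomogeneous_C (Fin 3) c).mul hg
        · rw [smul_eq_toRat, map_mul, ← q, mul_assoc]
    · obtain ⟨w, hw, H2⟩ := h2 p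
      refine ⟨w, hw, fun t ht => ?_⟩
      obtain ⟨u, hu, e⟩ := H2 t ht
      refine ⟨MvPolynomial.C c * u, Ideal.mul_mem_left _ _ hu, ?_⟩
      rw [smul_eq_toRat, map_mul _ (MvPolynomial.C c) u, ← e]
      ring

/-- `h⁰(A, 𝒪_A(D))` for the curve `A : F = 0`. -/
def h0 (F : Poly) (D : Divisor) : Cardinal := Module.rank ℂ (globalSections F D)

/-- `D ∼ D'` on the curve `F = 0`: the invertible sheaf of `D' - D` is trivial, that is, it has a
global section whose inverse is a global section of the dual sheaf. -/
def LinEquiv (F : Poly) (D D' : Divisor) : Prop :=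
  ∃ φ : (RatRing F)ˣ, (φ : RatRing F) ∈ globalSections F (D' - D) ∧
    ((φ⁻¹ : (RatRing F)ˣ) : RatRing F) ∈ globalSections F (D - D')

/-- The curve `G = 0` cuts out the divisor `D` on the curve `F = 0` (with multiplicities; in
particular the two curves have no common component). -/
def IsIntersectionDivisor (F G : Poly) (D : Divisor) : Prop :=
  D.2 = 0 ∧ ∀ p, 0 ≤ D.1 p ∧ intMult F G p = ((D.1 p).toNat : ℕ∞)

/-- The hypotheses of Dixon's algorithm for a possibly singular plane curve `F = 0` of degree `e`
and a divisor `D`: `D` is supported in the regular locus, `2 D` is the intersection divisor with a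
curve of degree `e - 1`, and `h⁰(D - H) = 0`. -/
def DixonHypotheses (F : Poly) (e : ℕ) (D : Divisor) : Prop :=
  F ≠ 0 ∧ F.IsHomogeneous e ∧ 1 ≤ e ∧ SupportedInRegularLocus F D ∧
    (∃ G : Poly, G.IsHomogeneous (e - 1) ∧ IsIntersectionDivisor F G (2 • D)) ∧
    h0 F (D - H) = 0

end PlaneCurve

open PlaneCurve

/-- The data of a polycon: equations `c i` of the boundary components `C i`, cyclically indexed,
and the explicit vertices, where `v i` is the vertex on `C i` and `C (i + 1)`. -/
structure PolyconData (n : ℕ) where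
  c : Fin n → Poly
  v : Fin n → Pt

namespace PolyconData

variable {n : ℕ}

/-- The equation of the algebraic boundary. -/
def boundary (P : PolyconData n) : Poly := ∏ i, P.c i

/-- The degree of the algebraic boundary. -/
def degree (P : PolyconData n) : ℕ := ∑ i, (P.c i).totalDegree

/-- The vertices: the explicit ones, and the singular points of the boundary conics
(the implicit ones). -/
def vertices (P : PolyconData n) : Set Pt := Set.range P.v ∪ ⋃ i, singularSet (P.c i)

/-- The residual arrangement: the singular points of the boundary that are not vertices. -/
def residual (P : PolyconData n) : Set Pt := singularSet P.boundary \ P.vertices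

/-- The data form a polycon. -/
structure IsPolycon [NeZero n] (P : PolyconData n) : Prop where
  two_le : 2 ≤ n
  homogeneous : ∀ i, (P.c i).IsHomogeneous (P.c i).totalDegree
  degree_eq : ∀ i, (P.c i).totalDegree = 1 ∨ (P.c i).totalDegree = 2
  reduced : ∀ i, Squarefree (P.c i)
  transversal : ∀ i, TransversalAt (P.c i) (P.c (i + 1)) (P.v i)
  other : ∀ i j, j ≠ i → j ≠ i + 1 → ¬ VanishesAt (P.c j) (P.v i)
  /-- The explicit vertices are distinct; this is automatic unless `n = 2`. -/
  injective : Function.Injective P.v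
  /-- An implicit vertex lies on no other boundary component. -/
  implicit : ∀ i j, j ≠ i → ∀ p ∈ singularSet (P.c i), ¬ VanishesAt (P.c j) p
  /-- The two explicit vertices on a singular conic lie on different lines of it. -/
  split : ∀ i, (P.c i).totalDegree = 2 → ∀ l : Poly, l.IsHomogeneous 1 → l ∣ P.c i →
    ¬ (VanishesAt l (P.v (i - 1)) ∧ VanishesAt l (P.v i))

/-- All singularities of the algebraic boundary are nodes. -/
def IsNodal (P : PolyconData n) : Prop := ∀ p ∈ singularSet P.boundary, IsNode P.boundary p

/-- `a` is an equation of the adjoint curve: a nonzero form of degree `deg P - 3` whose germs at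
the residual points lie in the conductor of the desingularization of the boundary there. -/
def IsAdjoint (P : PolyconData n) (a : Poly) : Prop :=
  a ≠ 0 ∧ a.IsHomogeneous (P.degree - 3) ∧ ∀ p ∈ P.residual, InConductorAt P.boundary a p

/-- Replace the boundary component `C i` by the line `l = 0`, keeping the explicit vertices. -/
def replaceByLine (P : PolyconData n) (i : Fin n) (l : Poly) : PolyconData n where
  c := Function.update P.c i l
  v := P.v

end PolyconData

end

/-! Write `c_j` for the components, `Q_j` for the product of the others, `d` for the degree. On
`C_j` take a form `s` of degree `3 - deg C_j` through the two explicit vertices of `C_j`. Then `α s`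
lies locally everywhere in `(Q_j, c_j)`: at residual points by the conductor condition, at explicit
vertices because `s` vanishes where `Q_j` and `c_j` are transversal. Max Noether's theorem
(`mem_span_of_forall_mem_locIdeal`) makes this global, and by degrees `α s = κ Q_j + t c_j` with `κ`
constant (`IsPolycon.exists_mul_eq`). If `κ = 0`, then `c_j` divides `α`, so `α` vanishes at the
next vertex, where comparing gradients kills the next constant; going round the cycle, every
component divides `α`, which its degree forbids (`IsPolycon.coeff_ne_zero`). Hence `α` is nonzero at
the explicit vertices, is unique up to a scalar, meets the boundary only in residual points, and is
transversal to both branches at each residual node; in particular `A` is smooth there.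

For a conic `C_i` and `s = l` the relation reads `c_i t = -κ Q_i + l α` with `deg t = d - 4`. Along
`A`, `t` is thus `Q_i / c_i` up to a scalar. At a residual point off `C_i` two branches of `Q_i`
each meet `A` simply, so `t` has contact of order two; at a residual point on `C_i` the simple zeros
of `Q_i` and `c_i` cancel. So `t` cuts out `2D`, where `D` is the set of residual points off `C_i`,
which is `R(P) ∩ R(P')`. If `P'` is a polycon with adjoint `β`, then `l α` and `c_i β` are
proportional on every other component, with equal constants since neighbours share a vertex; by
degrees `l α - μ c_i β = ν Q_i`, so `β` cuts out the same divisor as `t`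
(`NodalAdjoint.exists_mul_adjoint_eq`). The whole boundary cuts out `2 R(P)` on `A`.

For the vanishing (`NodalAdjoint.h0_eq_zero`), multiply a section of `D - H` by `Q_i`, or one of `R
- 3H` by the boundary. The result is a form of degree `d - 3` that vanishes on `R(P)`, since double
zeros outweigh simple poles. By uniqueness it is a multiple of `α`, that is, zero on `A`. -/

noncomputable section

open PlaneCurve MvPolynomial

/-! ### Commutative algebra and local geometry of plane curves -/

namespace PlaneCurve

/-! ### Homogeneous polynomials -/

theorem homogeneousComponent_mul_right {d : ℕ} {f : Poly} (hf : f.IsHomogeneous d) (a : Poly)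
    (n : ℕ) : homogeneousComponent n (a * f) =
      if d ≤ n then homogeneousComponent (n - d) a * f else 0 := by
  have key : ∀ i, homogeneousComponent n (homogeneousComponent i a * f) =
      if i + d = n then homogeneousComponent i a * f else 0 := fun i => by
    rw [homogeneousComponent_of_mem ((homogeneousComponent_isHomogeneous i a).mul hf)]
    simp only [eq_comm]
  conv_lhs => rw [← sum_homogeneousComponent a, Finset.sum_mul, map_sum]
  simp only [key]
  split_ifs with h
  · rw [Finset.sum_eq_single (n - d), if_pos (by omega)]
    · intro i _ hi
      rw [if_neg (by omega)]
    · intro hi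
      rw [homogeneousComponent_eq_zero _ _ (by simp at hi; omega), zero_mul, ite_self]
  · exact Finset.sum_eq_zero fun i _ => if_neg (by omega)

/-- An ideal that contains the homogeneous components of its elements. -/
def IsGradedIdeal (I : Ideal Poly) : Prop := ∀ f ∈ I, ∀ n, homogeneousComponent n f ∈ I

theorem isGradedIdeal_span {s : Set Poly} (hs : ∀ f ∈ s, ∃ d, f.IsHomogeneous d) :
    IsGradedIdeal (Ideal.span s) := by
  intro f hf n
  induction hf using Submodule.span_induction generalizing n with
  | mem x hx =>
    obtain ⟨d, hd⟩ := hs x hx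
    rw [homogeneousComponent_of_mem hd]
    split_ifs
    exacts [Ideal.subset_span hx, zero_mem _]
  | zero => simp
  | add x y _ _ h1 h2 => rw [map_add]; exact add_mem (h1 n) (h2 n)
  | smul a x _ h =>
    rw [← sum_homogeneousComponent x, smul_eq_mul, Finset.mul_sum, map_sum]
    refine sum_mem fun i _ => ?_
    rw [homogeneousComponent_mul_right (homogeneousComponent_isHomogeneous i x)]
    split_ifs
    exacts [Ideal.mul_mem_left _ _ (h i), zero_mem _]

theorem isGradedIdeal_span_pair {d e : ℕ} {f g : Poly} (hf : f.IsHomogeneous d)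
    (hg : g.IsHomogeneous e) : IsGradedIdeal (Ideal.span {f, g}) :=
  isGradedIdeal_span (by rintro x (rfl | rfl); exacts [⟨d, hf⟩, ⟨e, hg⟩])

theorem IsGradedIdeal.mul {I J : Ideal Poly} (hI : IsGradedIdeal I) (hJ : IsGradedIdeal J) :
    IsGradedIdeal (I * J) := by
  intro f hf n
  induction hf using Submodule.mul_induction_on' generalizing n with
  | mem_mul_mem a ha b hb =>
    rw [← sum_homogeneousComponent b, Finset.mul_sum, map_sum]
    refine sum_mem fun i _ => ?_
    rw [homogeneousComponent_mul_right (homogeneousComponent_isHomogeneous i b)]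
    split_ifs
    exacts [Ideal.mul_mem_mul (hI _ ha _) (hJ _ hb _), zero_mem _]
  | add x _ y _ h1 h2 => rw [map_add]; exact add_mem (h1 n) (h2 n)

theorem IsGradedIdeal.sup {I J : Ideal Poly} (hI : IsGradedIdeal I) (hJ : IsGradedIdeal J) :
    IsGradedIdeal (I ⊔ J) := by
  intro f hf n
  obtain ⟨a, ha, b, hb, rfl⟩ := Submodule.mem_sup.1 hf
  rw [map_add]
  exact Submodule.add_mem_sup (hI a ha n) (hJ b hb n)

/-- The coefficient of a homogeneous multiple may be taken homogeneous. -/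
theorem exists_homogeneous_coeff {d n : ℕ} {f : Poly} (hf : f.IsHomogeneous d) (a : Poly) :
    ∃ a' : Poly, a'.IsHomogeneous (n - d) ∧ homogeneousComponent n (a * f) = a' * f := by
  rw [homogeneousComponent_mul_right hf]
  split_ifs with h
  · exact ⟨_, homogeneousComponent_isHomogeneous _ _, rfl⟩
  -- For `n < d` the truncated degree `n - d` is `0`, which is harmless since the coefficient is
  -- zero.
  · exact ⟨0, isHomogeneous_zero _ _ _, (zero_mul f).symm⟩

theorem exists_homogeneous_eq_add {d e n : ℕ} {x f g : Poly} (hx : x.IsHomogeneous n)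
    (hf : f.IsHomogeneous d) (hg : g.IsHomogeneous e) (h : x ∈ Ideal.span {f, g}) :
    ∃ a b : Poly, a.IsHomogeneous (n - d) ∧ b.IsHomogeneous (n - e) ∧ x = a * f + b * g := by
  obtain ⟨a, b, rfl⟩ := Ideal.mem_span_pair.1 h
  obtain ⟨a', ha', ea⟩ := exists_homogeneous_coeff (n := n) hf a
  obtain ⟨b', hb', eb⟩ := exists_homogeneous_coeff (n := n) hg b
  refine ⟨a', b', ha', hb', ?_⟩
  rw [← ea, ← eb, ← map_add, homogeneousComponent_eq_self hx]

theorem exists_homogeneous_eq_mul {d n : ℕ} {x f : Poly} (hx : x.IsHomogeneous n)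
    (hf : f.IsHomogeneous d) (h : f ∣ x) : ∃ a : Poly, a.IsHomogeneous (n - d) ∧ x = a * f := by
  obtain ⟨a, rfl⟩ := h
  obtain ⟨a', ha', ea⟩ := exists_homogeneous_coeff (n := n) hf a
  exact ⟨a', ha', by rw [← ea, mul_comm a, homogeneousComponent_eq_self hx]⟩

theorem exists_eq_C {f : Poly} (hf : f.IsHomogeneous 0) : ∃ c : ℂ, f = C c :=
  ⟨_, totalDegree_eq_zero_iff_eq_C.1 ((totalDegree_zero_iff_isHomogeneous _).2 hf)⟩

/-- A nonzero form that divides a form of smaller degree divides only zero. -/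
theorem eq_zero_of_dvd {d n : ℕ} {x f : Poly} (hx : x.IsHomogeneous n) (hf : f.IsHomogeneous d)
    (h : f ∣ x) (hlt : n < d) : x = 0 := by
  by_contra h0
  obtain ⟨a, rfl⟩ := h
  have h1 := totalDegree_mul_of_isDomain (left_ne_zero_of_mul h0) (right_ne_zero_of_mul h0)
  rw [hx.totalDegree h0, hf.totalDegree (left_ne_zero_of_mul h0)] at h1
  omega

theorem exists_eq_C_mul {n : ℕ} {x f : Poly} (hx : x.IsHomogeneous n) (hf : f.IsHomogeneous n)
    (h : f ∣ x) : ∃ c : ℂ, x = C c * f := by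
  obtain ⟨a, ha, rfl⟩ := exists_homogeneous_eq_mul hx hf h
  rw [Nat.sub_self] at ha
  obtain ⟨c, rfl⟩ := exists_eq_C ha
  exact ⟨c, rfl⟩

theorem irreducible_of_isHomogeneous_one {f : Poly} (hf : f.IsHomogeneous 1) (h0 : f ≠ 0) :
    Irreducible f := by
  refine irreducible_of_totalDegree_eq_one (hf.totalDegree h0) fun x hx => ?_
  rw [isUnit_iff_ne_zero]
  rintro rfl
  exact h0 (MvPolynomial.ext _ _ fun i => by simpa using hx i)

theorem eval_smul_of_isHomogeneous {n : ℕ} {f : Poly} (hf : f.IsHomogeneous n) (c : ℂ)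
    (v : Fin 3 → ℂ) : eval (c • v) f = c ^ n * eval v f := by
  rw [eval_eq, eval_eq, Finset.mul_sum]
  refine Finset.sum_congr rfl fun s hs => ?_
  simp only [Pi.smul_apply, smul_eq_mul, mul_pow, Finset.prod_mul_distrib, Finset.prod_pow_eq_pow_sum]
  rw [hf.degree_eq_sum_deg_support hs]
  ring

/-! ### The homogeneous ideal of a point -/

/-- Restriction of a polynomial to the line spanned by `v`. -/
def lineEval (v : Fin 3 → ℂ) : Poly →ₐ[ℂ] Polynomial ℂ :=
  aeval fun j => Polynomial.C (v j) * Polynomial.X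

theorem mem_ptIdeal {f : Poly} {p : Pt} : f ∈ ptIdeal p ↔ lineEval p.rep f = 0 := Iff.rfl

theorem lineEval_of_isHomogeneous {n : ℕ} {f : Poly} (hf : f.IsHomogeneous n) (v : Fin 3 → ℂ) :
    lineEval v f = Polynomial.C (eval v f) * Polynomial.X ^ n := by
  rw [lineEval, aeval_def, eval₂_eq, eval_eq, map_sum, Finset.sum_mul]
  refine Finset.sum_congr rfl fun s hs => ?_
  rw [hf.degree_eq_sum_deg_support hs]
  simp only [mul_pow, Finset.prod_mul_distrib, Finset.prod_pow_eq_pow_sum, map_mul, map_prod,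
    map_pow]
  rw [mul_assoc]
  rfl

theorem coeff_lineEval (f : Poly) (v : Fin 3 → ℂ) (n : ℕ) :
    (lineEval v f).coeff n = eval v (homogeneousComponent n f) := by
  conv_lhs => rw [← sum_homogeneousComponent f]
  rw [map_sum, Polynomial.finsetSum_coeff]
  simp only [lineEval_of_isHomogeneous (homogeneousComponent_isHomogeneous _ f),
    Polynomial.coeff_C_mul_X_pow]
  rw [Finset.sum_ite_eq, ite_eq_left_iff]
  intro h
  rw [homogeneousComponent_eq_zero _ _ (by simpa using h), map_zero]

theorem mem_ptIdeal_iff_homogeneousComponent {f : Poly} {p : Pt} :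
    f ∈ ptIdeal p ↔ ∀ n, VanishesAt (homogeneousComponent n f) p := by
  rw [mem_ptIdeal, Polynomial.ext_iff]
  simp only [coeff_lineEval, Polynomial.coeff_zero, VanishesAt]

theorem mem_ptIdeal_of_isHomogeneous {n : ℕ} {f : Poly} (hf : f.IsHomogeneous n) {p : Pt} :
    f ∈ ptIdeal p ↔ VanishesAt f p := by
  rw [mem_ptIdeal, lineEval_of_isHomogeneous hf]
  simp [VanishesAt]

theorem vanishesAt_of_mem_ptIdeal {f : Poly} {p : Pt} (h : f ∈ ptIdeal p) : VanishesAt f p := by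
  rw [VanishesAt, ← sum_homogeneousComponent f, map_sum]
  exact Finset.sum_eq_zero fun n _ => mem_ptIdeal_iff_homogeneousComponent.1 h n

theorem isGradedIdeal_ptIdeal (p : Pt) : IsGradedIdeal (ptIdeal p) := fun f hf n =>
  (mem_ptIdeal_of_isHomogeneous (homogeneousComponent_isHomogeneous n f)).2
    (mem_ptIdeal_iff_homogeneousComponent.1 hf n)

theorem exists_rep_ne_zero (p : Pt) : ∃ k, p.rep k ≠ 0 := by
  by_contra! h
  exact p.rep_nonzero (funext h)

theorem vanishesAt_mul {f g : Poly} {p : Pt} :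
    VanishesAt (f * g) p ↔ VanishesAt f p ∨ VanishesAt g p := by
  simp [VanishesAt]

theorem vanishesAt_prod {ι : Type*} {s : Finset ι} {f : ι → Poly} {p : Pt} :
    VanishesAt (∏ i ∈ s, f i) p ↔ ∃ i ∈ s, VanishesAt (f i) p := by
  simp [VanishesAt, map_prod, Finset.prod_eq_zero_iff]

theorem vanishesAt_of_dvd {f g : Poly} {p : Pt} (h : f ∣ g) (hf : VanishesAt f p) :
    VanishesAt g p := by
  obtain ⟨k, rfl⟩ := h
  exact vanishesAt_mul.2 (Or.inl hf)

/-- The ideal of a point is generated by two linear forms. -/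
theorem exists_ptIdeal_eq_span (p : Pt) : ∃ f g : Poly, f.IsHomogeneous 1 ∧ g.IsHomogeneous 1 ∧
    ptIdeal p = Ideal.span {f, g} := by
  obtain ⟨k, hk⟩ := exists_rep_ne_zero p
  set v := p.rep with hv
  let m : Fin 3 → Poly := fun i => X i - C (v i / v k) * X k
  have hm : ∀ i, (m i).IsHomogeneous 1 := fun i =>
    (isHomogeneous_X ℂ i).sub (isHomogeneous_C_mul_X _ _)
  have hmem : ∀ i, m i ∈ ptIdeal p := fun i => by
    rw [mem_ptIdeal_of_isHomogeneous (hm i), VanishesAt, ← hv]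
    simp [m, div_mul_cancel₀ _ hk]
  have hmk : m k = 0 := by simp [m, div_self hk]
  refine ⟨m (k.succAbove 0), m (k.succAbove 1), hm _, hm _, le_antisymm (fun f hf => ?_) ?_⟩
  · set I := Ideal.span {m (k.succAbove 0), m (k.succAbove 1)}
    have hmI : ∀ i, m i ∈ I := by
      intro i
      rcases eq_or_ne i k with rfl | hi
      · rw [hmk]; exact zero_mem _
      · obtain ⟨j, rfl⟩ := Fin.exists_succAbove_eq hi
        fin_cases j
        · exact Ideal.subset_span (by simp)
        · exact Ideal.subset_span (by simp)
    -- `θ` writes the parameter of the line `ℂ · p` as `X k / v k`. Modulo the forms `m i`, every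
    -- polynomial equals `θ` of its restriction to this line, so one that restricts to zero lies in
    -- `I`.
    let θ : Polynomial ℂ →ₐ[ℂ] Poly := Polynomial.aeval (C (v k)⁻¹ * X k)
    have h1 : (Ideal.Quotient.mkₐ ℂ I) = (Ideal.Quotient.mkₐ ℂ I).comp (θ.comp (lineEval v)) := by
      refine MvPolynomial.algHom_ext fun i => ?_
      have : Ideal.Quotient.mkₐ ℂ I (m i) = 0 := Ideal.Quotient.eq_zero_iff_mem.2 (hmI i)
      rw [map_sub, sub_eq_zero] at this
      rw [this, AlgHom.comp_apply, AlgHom.comp_apply]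
      congr 1
      simp only [lineEval, aeval_X, θ, map_mul, Polynomial.aeval_C, Polynomial.aeval_X]
      rw [div_eq_mul_inv, C_mul, mul_assoc]
      rfl
    have h2 := DFunLike.congr_fun h1 f
    rw [AlgHom.comp_apply, AlgHom.comp_apply, show lineEval v f = 0 from hf, map_zero,
      map_zero] at h2
    exact Ideal.Quotient.eq_zero_iff_mem.1 h2
  · rw [Ideal.span_le]
    rintro x (rfl | rfl)
    exacts [hmem _, hmem _]

/-! ### Gradients -/

theorem grad_add (f g : Poly) (p : Pt) : grad (f + g) p = grad f p + grad g p := by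
  ext j; simp [grad]

theorem grad_mul (f g : Poly) (p : Pt) :
    grad (f * g) p = eval p.rep f • grad g p + eval p.rep g • grad f p := by
  ext j
  simp [grad, Derivation.leibniz]

theorem grad_C_mul (c : ℂ) (g : Poly) (p : Pt) : grad (C c * g) p = c • grad g p := by
  ext j; simp [grad, Derivation.leibniz]

/-- If two forms vanish at `p`, with independent gradients, they generate the ideal of `p`
locally. -/
theorem exists_mul_mem_span_of_transversalAt {f g : Poly} {p : Pt} (hf : f ∈ ptIdeal p)
    (hg : g ∈ ptIdeal p) (h : LinearIndependent ℂ ![grad f p, grad g p]) :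
    ∃ w ∉ ptIdeal p, ∀ x ∈ ptIdeal p, w * x ∈ Ideal.span {f, g} := by
  obtain ⟨l, m, hl, hm, e⟩ := exists_ptIdeal_eq_span p
  have hlp : VanishesAt l p := vanishesAt_of_mem_ptIdeal (e ▸ Ideal.subset_span (by simp))
  have hmp : VanishesAt m p := vanishesAt_of_mem_ptIdeal (e ▸ Ideal.subset_span (by simp))
  rw [e, Ideal.mem_span_pair] at hf hg
  obtain ⟨a, b, rfl⟩ := hf
  obtain ⟨c, d, rfl⟩ := hg
  -- The unit is the determinant of the change of generators from `l, m` to `f, g`; at `p` it is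
  -- nonzero because the gradients are independent, and Cramer's rule recovers `l` and `m`.
  refine ⟨a * d - b * c, fun hw => ?_, fun x hx => ?_⟩
  · have hw := vanishesAt_of_mem_ptIdeal hw
    simp only [VanishesAt, map_sub, map_mul] at hlp hmp hw
    simp only [grad_add, grad_mul, hlp, hmp, zero_smul, add_zero] at h
    rw [LinearIndependent.pair_iff] at h
    have h1 := h (eval p.rep c) (-eval p.rep a) ?_
    have h2 := h (eval p.rep d) (-eval p.rep b) ?_
    · rw [h1.1, neg_eq_zero.1 h1.2, h2.1, neg_eq_zero.1 h2.2] at h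
      simpa using h 1 1
    · match_scalars <;> first | ring1 | linear_combination hw
    · match_scalars <;> first | ring1 | linear_combination hw | linear_combination -hw
  · rw [e, Ideal.mem_span_pair] at hx
    obtain ⟨s, t, rfl⟩ := hx
    rw [Ideal.mem_span_pair]
    exact ⟨s * d - t * c, t * a - s * b, by ring⟩

/-! ### Local membership in an ideal -/

/-- The polynomials that lie in `I` locally at `p`. -/
def locIdeal (I : Ideal Poly) (p : Pt) : Ideal Poly :=
  (I.map (algebraMap Poly (Localization.AtPrime (ptIdeal p)))).comap
    (algebraMap Poly (Localization.AtPrime (ptIdeal p)))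

theorem mem_locIdeal {I : Ideal Poly} {p : Pt} {x : Poly} :
    x ∈ locIdeal I p ↔ ∃ w ∉ ptIdeal p, w * x ∈ I :=
  IsLocalization.algebraMap_mem_map_algebraMap_iff (ptIdeal p).primeCompl _ I x

theorem le_locIdeal (I : Ideal Poly) (p : Pt) : I ≤ locIdeal I p := Ideal.le_comap_map

theorem locIdeal_le_locIdeal {I J : Ideal Poly} {p : Pt} (h : I ≤ locIdeal J p) :
    locIdeal I p ≤ locIdeal J p :=
  Ideal.comap_mono (Ideal.map_le_iff_le_comap.2 h)

theorem mul_notMem_ptIdeal {p : Pt} {u w : Poly} (hu : u ∉ ptIdeal p) (hw : w ∉ ptIdeal p) :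
    u * w ∉ ptIdeal p := fun h => ((ptIdeal_isPrime p).mem_or_mem h).elim hu hw

theorem one_notMem_ptIdeal (p : Pt) : (1 : Poly) ∉ ptIdeal p :=
  (Ideal.ne_top_iff_one _).1 (ptIdeal_isPrime p).ne_top

theorem mem_locIdeal_of_mul_mem {I : Ideal Poly} {p : Pt} {u x : Poly} (hu : u ∉ ptIdeal p)
    (h : u * x ∈ locIdeal I p) : x ∈ locIdeal I p := by
  obtain ⟨w, hw, h⟩ := mem_locIdeal.1 h
  exact mem_locIdeal.2 ⟨w * u, mul_notMem_ptIdeal hw hu, by rwa [mul_assoc]⟩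

theorem mem_locIdeal_of_notMem {I : Ideal Poly} {p : Pt} {u : Poly} (hu : u ∉ ptIdeal p)
    (h : u ∈ I) (x : Poly) : x ∈ locIdeal I p :=
  mem_locIdeal.2 ⟨u, hu, Ideal.mul_mem_right _ _ h⟩

theorem locIdeal_le_ptIdeal {I : Ideal Poly} {p : Pt} (h : I ≤ ptIdeal p) :
    locIdeal I p ≤ ptIdeal p := by
  intro x hx
  obtain ⟨w, hw, hx⟩ := mem_locIdeal.1 hx
  exact ((ptIdeal_isPrime p).mem_or_mem (h hx)).resolve_left hw

/-- A local inclusion of ideals has a common denominator. -/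
theorem exists_mul_mem_of_le_locIdeal {I J : Ideal Poly} {p : Pt} (h : J ≤ locIdeal I p) :
    ∃ w ∉ ptIdeal p, ∀ x ∈ J, w * x ∈ I := by
  obtain ⟨s, hs⟩ := IsNoetherian.noetherian J
  have hm : ∀ x ∈ s, ∃ w ∉ ptIdeal p, w * x ∈ I := fun x hx =>
    mem_locIdeal.1 (h (hs ▸ Submodule.subset_span hx))
  choose! w hw hx using hm
  refine ⟨∏ y ∈ s, w y, fun hc => ?_, fun x hxJ => ?_⟩
  · obtain ⟨y, hy, hc⟩ := (ptIdeal_isPrime p).prod_mem_iff.1 hc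
    exact hw y hy hc
  · have : J ≤ Submodule.comap (LinearMap.mulLeft Poly (∏ y ∈ s, w y)) I := by
      rw [← hs, Submodule.span_le]
      intro y hy
      rw [SetLike.mem_coe, Submodule.mem_comap, LinearMap.mulLeft_apply,
        ← Finset.prod_erase_mul _ _ hy, mul_assoc]
      exact Ideal.mul_mem_left _ _ (hx y hy)
    exact this hxJ

/-- For a form and a graded ideal, the denominator may be taken to be a form. -/
theorem exists_isHomogeneous_mul_mem {I : Ideal Poly} (hI : IsGradedIdeal I) {p : Pt} {n : ℕ}
    {x : Poly} (hx : x.IsHomogeneous n) (h : x ∈ locIdeal I p) :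
    ∃ (k : ℕ) (w : Poly), w.IsHomogeneous k ∧ ¬ VanishesAt w p ∧ w * x ∈ I := by
  obtain ⟨w, hw, h⟩ := mem_locIdeal.1 h
  rw [mem_ptIdeal_iff_homogeneousComponent] at hw
  push Not at hw
  obtain ⟨k, hk⟩ := hw
  refine ⟨k, _, homogeneousComponent_isHomogeneous k w, hk, ?_⟩
  have := hI _ h (k + n)
  rwa [homogeneousComponent_mul_right hx, if_pos (by omega), Nat.add_sub_cancel] at this

theorem ptIdeal_le_locIdeal_of_transversalAt {f g : Poly} {p : Pt} (hf : f ∈ ptIdeal p)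
    (hg : g ∈ ptIdeal p) (h : LinearIndependent ℂ ![grad f p, grad g p]) :
    ptIdeal p ≤ locIdeal (Ideal.span {f, g}) p := fun x hx => by
  obtain ⟨w, hw, H⟩ := exists_mul_mem_span_of_transversalAt hf hg h
  exact mem_locIdeal.2 ⟨w, hw, H x hx⟩

/-! ### Max Noether's theorem -/

/-- Membership in a monomial ideal is decided monomial by monomial, and the generators do not
involve `X 2`. -/
theorem X_pow_mul_mem_span {k : Poly} {a b c : ℕ}
    (h : X 2 ^ c * k ∈ Ideal.span {(X 0 ^ a : Poly), X 1 ^ b}) :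
    k ∈ Ideal.span {(X 0 ^ a : Poly), X 1 ^ b} := by
  have e : ({X 0 ^ a, X 1 ^ b} : Set Poly) = (fun s => monomial s (1 : ℂ)) ''
      {Finsupp.single 0 a, Finsupp.single 1 b} := by
    simp [Set.image_pair, X_pow_eq_monomial]
  rw [e, mem_ideal_span_monomial_image] at h ⊢
  intro s hs
  obtain ⟨t, ht, hle⟩ := h (Finsupp.single 2 c + s) (by
    rw [mem_support_iff, X_pow_eq_monomial, coeff_monomial_mul, one_mul]
    exact mem_support_iff.1 hs)
  refine ⟨t, ht, ?_⟩
  rcases ht with rfl | rfl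
  · rw [Finsupp.single_le_iff] at hle ⊢
    simpa using hle
  · rw [Finsupp.single_le_iff] at hle ⊢
    simpa using hle

theorem isRelPrime_X_pow {i j : Fin 3} (h : i ≠ j) (a b : ℕ) :
    IsRelPrime (X i ^ a : Poly) (X j ^ b) := by
  refine IsRelPrime.pow ?_
  rw [(irreducible_of_isHomogeneous_one (isHomogeneous_X ℂ i) (X_ne_zero i)).isRelPrime_iff_not_dvd,
    X_dvd_X]
  simpa using h

/-- The ideal of two coprime forms is saturated. Two representations of multiples of `x` differ by a
Koszul syzygy `k • (g, f)`; comparing all three powers puts `k` in the ideal of two of them, and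
correcting the representation of `X 0 ^ a * x` by that syzygy makes both coefficients divisible by
`X 0 ^ a`. -/
theorem mem_span_of_X_pow_mul_mem {f g x : Poly} (hfg : IsRelPrime f g) (hg : g ≠ 0) {a b c : ℕ}
    (h0 : X 0 ^ a * x ∈ Ideal.span {f, g}) (h1 : X 1 ^ b * x ∈ Ideal.span {f, g})
    (h2 : X 2 ^ c * x ∈ Ideal.span {f, g}) : x ∈ Ideal.span {f, g} := by
  have hA0 : (X 0 ^ a : Poly) ≠ 0 := pow_ne_zero _ (X_ne_zero 0)
  have hAB : IsRelPrime (X 0 ^ a : Poly) (X 1 ^ b) := isRelPrime_X_pow (by decide) a b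
  have hk := fun k => X_pow_mul_mem_span (k := k) (a := a) (b := b) (c := c)
  generalize (X 0 ^ a : Poly) = A at *
  generalize (X 1 ^ b : Poly) = B at *
  generalize (X 2 ^ c : Poly) = E at *
  obtain ⟨a1, b1, e1⟩ := Ideal.mem_span_pair.1 h0
  obtain ⟨a2, b2, e2⟩ := Ideal.mem_span_pair.1 h1
  obtain ⟨a3, b3, e3⟩ := Ideal.mem_span_pair.1 h2
  obtain ⟨k, ek⟩ : g ∣ B * a1 - A * a2 := hfg.symm.dvd_of_dvd_mul_right
    (Dvd.intro (A * b2 - B * b1) (by linear_combination A * e2 - B * e1))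
  obtain ⟨k', ek'⟩ : g ∣ E * a1 - A * a3 := hfg.symm.dvd_of_dvd_mul_right
    (Dvd.intro (A * b3 - E * b1) (by linear_combination A * e3 - E * e1))
  obtain ⟨k'', ek''⟩ : g ∣ B * a3 - E * a2 := hfg.symm.dvd_of_dvd_mul_right
    (Dvd.intro (E * b2 - B * b3) (by linear_combination E * e2 - B * e3))
  have ekf : A * b2 - B * b1 = k * f := mul_right_cancel₀ hg (by
    linear_combination A * e2 - B * e1 + f * ek)
  have hkE : E * k = k'' * A + k' * B := mul_right_cancel₀ hg (by
    linear_combination B * ek' + A * ek'' - E * ek)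
  -- With `k = s A + r B`, the representation `A x = (a1 - r g) f + (b1 + r f) g` has both
  -- coefficients divisible by `A`.
  obtain ⟨s, r, es⟩ := Ideal.mem_span_pair.1 (hk k (Ideal.mem_span_pair.2 ⟨k'', k', hkE.symm⟩))
  obtain ⟨t, et⟩ : A ∣ a1 - r * g := hAB.dvd_of_dvd_mul_left
    (Dvd.intro (a2 + s * g) (by linear_combination -ek + g * es))
  obtain ⟨u, eu⟩ : A ∣ b1 + r * f := hAB.dvd_of_dvd_mul_left
    (Dvd.intro (b2 - s * f) (by linear_combination ekf - f * es))
  exact Ideal.mem_span_pair.2 ⟨t, u, mul_left_cancel₀ hA0 (by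
    linear_combination e1 - f * et - g * eu)⟩

/-- Max Noether's theorem: membership of a form in the ideal of two coprime forms can be tested
locally. -/
theorem mem_span_of_forall_mem_locIdeal {f g x : Poly} {d e n : ℕ} (hfg : IsRelPrime f g)
    (hg0 : g ≠ 0) (hf : f.IsHomogeneous d) (hg : g.IsHomogeneous e) (hx : x.IsHomogeneous n)
    (h : ∀ p, x ∈ locIdeal (Ideal.span {f, g}) p) : x ∈ Ideal.span {f, g} := by
  -- `J` is the colon ideal of `x`. The local hypothesis leaves it no zero other than possibly the
  -- origin, so by the Nullstellensatz it contains a power of each variable.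
  let J : Ideal Poly := Submodule.comap (LinearMap.mulRight Poly x) (Ideal.span {f, g})
  have hJ : ∀ w, w ∈ J ↔ w * x ∈ Ideal.span {f, g} := fun w => Iff.rfl
  have key : ∀ i : Fin 3, ∃ N : ℕ, X i ^ N * x ∈ Ideal.span {f, g} := fun i => by
    have : (X i : Poly) ∈ J.radical := by
      rw [← vanishingIdeal_zeroLocus_eq_radical (K := ℂ), mem_vanishingIdeal_iff]
      intro v hv
      rw [aeval_X]
      by_cases hv0 : v = 0
      · rw [hv0]; rfl
      exfalso
      obtain ⟨k, w, hw, hwp, hwx⟩ := exists_isHomogeneous_mul_mem (isGradedIdeal_span_pair hf hg)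
        hx (h (Projectivization.mk ℂ v hv0))
      obtain ⟨c, hc⟩ := Projectivization.exists_smul_eq_mk_rep ℂ v hv0
      refine hwp ?_
      rw [VanishesAt, ← hc, Units.smul_def, eval_smul_of_isHomogeneous hw]
      have := mem_zeroLocus_iff.1 hv w ((hJ w).2 hwx)
      rw [aeval_eq_eval] at this
      rw [show eval v w = 0 from this, mul_zero]
    obtain ⟨N, hN⟩ := this
    exact ⟨N, (hJ _).1 hN⟩
  obtain ⟨a, ha⟩ := key 0
  obtain ⟨b, hb⟩ := key 1
  obtain ⟨c, hc⟩ := key 2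
  exact mem_span_of_X_pow_mul_mem hfg hg0 ha hb hc

/-! ### Two facts about commutative rings -/

/-- Elements of the conductor split along the idempotent defined by a decomposition into two
components. -/
theorem exists_mul_add_eq_of_mem_conductorIdeal {R : Type*} [CommRing R] {x y a : R}
    (hxy : x * y = 0) (hs : x + y ∈ nonZeroDivisors R) (ha : a ∈ conductorIdeal R) :
    ∃ r, r * (x + y) = a * x := by
  let A := algebraMap R (FractionRing R)
  have hunit : IsUnit (A (x + y)) :=
    IsLocalization.map_units (FractionRing R) (⟨_, hs⟩ : nonZeroDivisors R)
  obtain ⟨v, hv⟩ := hunit.exists_right_inv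
  have h0 : A x * A y = 0 := by rw [← map_mul, hxy, map_zero]
  have hv' : (A x + A y) * v = 1 := by rw [← map_add, hv]
  -- `x / (x + y)` is idempotent because `x y = 0`, hence integral: it is the function `1` on one
  -- component and `0` on the other. The conductor multiplies it into `R`.
  have hz : (A x * v) * (A x * v) = A x * v := by
    linear_combination v * A x * hv' - v * v * h0
  obtain ⟨r, hr⟩ := ha (A x * v)
    ⟨Polynomial.X ^ 2 - Polynomial.X, by monicity!, by simp [sq, hz]⟩
  change A r = A a * (A x * v) at hr
  refine ⟨r, IsFractionRing.injective R (FractionRing R) ?_⟩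
  change A (r * (x + y)) = A (a * x)
  rw [map_mul, map_mul]
  linear_combination A (x + y) * hr + A a * A x * hv

/-- Multiplication by `z` embeds the residue field in `R ⧸ J`, with the residue field as quotient,
so the length is `1 + 1`. -/
theorem length_quotient_eq_two {R : Type*} [CommRing R] [IsLocalRing R] {J : Ideal R} {z : R}
    (hJ : J ≤ IsLocalRing.maximalIdeal R) (hz : z ∈ IsLocalRing.maximalIdeal R) (hzJ : z ∉ J)
    (hmul : ∀ r ∈ IsLocalRing.maximalIdeal R, r * z ∈ J)
    (hgen : ∀ r ∈ IsLocalRing.maximalIdeal R, ∃ s, r - s * z ∈ J) :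
    Module.length R (R ⧸ J) = 2 := by
  set K := IsLocalRing.maximalIdeal R
  let F : (R ⧸ K) →ₗ[R] (R ⧸ J) :=
    Submodule.mapQ K J (LinearMap.toSpanSingleton _ _ z) (fun r hr => hmul r hr)
  let G : (R ⧸ J) →ₗ[R] (R ⧸ K) := Submodule.mapQ J K LinearMap.id hJ
  have hFm : ∀ r : R, F (Submodule.Quotient.mk r) = Submodule.Quotient.mk (r * z) := fun _ => rfl
  have hGm : ∀ r : R, G (Submodule.Quotient.mk r) = Submodule.Quotient.mk r := fun _ => rfl
  have hF : Function.Injective F := by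
    rw [injective_iff_map_eq_zero]
    intro r hr
    obtain ⟨r, rfl⟩ := Submodule.Quotient.mk_surjective _ r
    rw [hFm, Submodule.Quotient.mk_eq_zero] at hr
    rw [Submodule.Quotient.mk_eq_zero]
    by_contra hrK
    rw [IsLocalRing.notMem_maximalIdeal] at hrK
    exact hzJ ((Ideal.unit_mul_mem_iff_mem _ hrK).1 hr)
  have hG : Function.Surjective G := fun r => by
    obtain ⟨r, rfl⟩ := Submodule.Quotient.mk_surjective _ r
    exact ⟨_, hGm r⟩
  have hFG : Function.Exact F G := by
    intro r
    obtain ⟨r, rfl⟩ := Submodule.Quotient.mk_surjective _ r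
    constructor
    · intro hr
      rw [hGm, Submodule.Quotient.mk_eq_zero] at hr
      obtain ⟨s, hs⟩ := hgen r hr
      refine ⟨Submodule.Quotient.mk s, ?_⟩
      rw [hFm, eq_comm, Submodule.Quotient.eq]
      exact hs
    · rintro ⟨s, hs⟩
      obtain ⟨s, rfl⟩ := Submodule.Quotient.mk_surjective _ s
      rw [← hs, hFm, hGm, Submodule.Quotient.mk_eq_zero]
      exact Ideal.mul_mem_left _ _ hz
  have hsimple : IsSimpleModule R (R ⧸ K) :=
    isSimpleModule_iff_isCoatom.2 (IsLocalRing.maximalIdeal.isMaximal R).out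
  rw [Module.length_eq_add_of_exact F G hF hG hFG, Module.length_eq_one]
  norm_num

/-! ### Germs in the local ring of the plane -/

/-- The (nonhomogeneous) localization of `Poly` at the ideal of `p`. -/
abbrev PtLoc (p : Pt) : Type := Localization.AtPrime (ptIdeal p)

/-- The map from polynomials to the localization at the ideal of `p`. -/
abbrev toLoc (p : Pt) : Poly →+* PtLoc p := algebraMap Poly (PtLoc p)

theorem isUnit_toLoc {p : Pt} {w : Poly} (hw : w ∉ ptIdeal p) : IsUnit (toLoc p w) :=
  IsLocalization.map_units (PtLoc p) (⟨w, hw⟩ : (ptIdeal p).primeCompl)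

theorem mem_stalkIdeal {I : Ideal Poly} {p : Pt} {r : LocalRingAt p} :
    r ∈ stalkIdeal I p ↔ r.val ∈ I.map (toLoc p) := Iff.rfl

theorem toLoc_mem_map {I : Ideal Poly} {p : Pt} {x : Poly} :
    toLoc p x ∈ I.map (toLoc p) ↔ x ∈ locIdeal I p := Iff.rfl

theorem X_notMem_ptIdeal {p : Pt} {k : Fin 3} (hk : p.rep k ≠ 0) (n : ℕ) :
    (X k ^ n : Poly) ∉ ptIdeal p := by
  rw [mem_ptIdeal_of_isHomogeneous (isHomogeneous_X_pow k n)]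
  simpa [VanishesAt] using fun h => absurd h hk

/-- The germ at `p` of a form, in a local trivialization of the line bundle. -/
theorem exists_germ (p : Pt) {n : ℕ} {x : Poly} (hx : x.IsHomogeneous n) :
    ∃ (r : LocalRingAt p) (u : PtLoc p), IsUnit u ∧ toLoc p x = r.val * u := by
  obtain ⟨k, hk⟩ := exists_rep_ne_zero p
  have hX := X_notMem_ptIdeal hk n
  refine ⟨HomogeneousLocalization.mk ⟨n, ⟨x, hx⟩, ⟨X k ^ n, ?_⟩, hX⟩, toLoc p (X k ^ n),
    isUnit_toLoc hX, ?_⟩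
  · simpa using isHomogeneous_X_pow (R := ℂ) k n
  · rw [HomogeneousLocalization.val_mk, Localization.mk_eq_mk']
    exact (IsLocalization.mk'_spec (PtLoc p) x ⟨X k ^ n, hX⟩).symm

/-- Coprimality of polynomials survives localization: clear the denominators and cancel `q` in
`Poly`. -/
theorem toLoc_dvd_of_dvd_mul {p : Pt} {c q : Poly} (h : IsRelPrime c q) {z : PtLoc p}
    (hz : toLoc p c ∣ toLoc p q * z) : toLoc p c ∣ z := by
  obtain ⟨⟨a, s⟩, e⟩ := IsLocalization.surj (ptIdeal p).primeCompl z
  have hs : IsUnit (toLoc p s) := isUnit_toLoc s.2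
  simp only at e
  rw [← hs.dvd_mul_right, e]
  have h1 : toLoc p c ∣ toLoc p (q * a) := by
    rw [map_mul, ← e, ← mul_assoc]
    exact hz.mul_right _
  have hd : ∀ x, toLoc p c ∣ toLoc p x ↔ x ∈ locIdeal (Ideal.span {c}) p := fun x => by
    rw [← toLoc_mem_map, Ideal.map_span, Set.image_singleton, Ideal.mem_span_singleton]
  rw [hd, mem_locIdeal] at h1 ⊢
  obtain ⟨w, hw, h1⟩ := h1
  refine ⟨w, hw, ?_⟩
  rw [Ideal.mem_span_singleton] at h1 ⊢
  exact h.dvd_of_dvd_mul_left (by rwa [mul_left_comm] at h1)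

/-- The conductor of the union of two curves without common component lies in the ideal generated
by their equations. -/
theorem mem_locIdeal_of_inConductorAt {c q a : Poly} {i j k : ℕ} {p : Pt} (hc : c.IsHomogeneous i)
    (hq : q.IsHomogeneous j) (ha : a.IsHomogeneous k) (hcq : IsRelPrime c q)
    (h : InConductorAt (c * q) a p) : a ∈ locIdeal (Ideal.span {q, c}) p := by
  obtain ⟨rc, uc, huc, ec⟩ := exists_germ p hc
  obtain ⟨rq, uq, huq, eq⟩ := exists_germ p hq
  obtain ⟨ra, ua, hua, ea⟩ := exists_germ p ha
  set S := stalkIdeal (Ideal.span {c * q}) p with hS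
  have hmem : ∀ r : LocalRingAt p, r ∈ S ↔ toLoc p c * toLoc p q ∣ r.val := fun r => by
    rw [hS, mem_stalkIdeal, Ideal.map_span, Set.image_singleton, Ideal.mem_span_singleton, map_mul]
  have hdvd : ∀ (r : LocalRingAt p), rc.val ∣ r.val ↔ toLoc p c ∣ r.val := fun r => by
    rw [ec, huc.mul_right_dvd]
  have hdvd' : ∀ (r : LocalRingAt p), rq.val ∣ r.val ↔ toLoc p q ∣ r.val := fun r => by
    rw [eq, huq.mul_right_dvd]
  have hcan : ∀ r : LocalRingAt p, toLoc p c ∣ (rq * r).val → toLoc p c ∣ r.val := fun r hr => by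
    refine toLoc_dvd_of_dvd_mul hcq ?_
    rw [eq, mul_right_comm, ← HomogeneousLocalization.val_mul]
    exact hr.mul_right _
  have hcan' : ∀ r : LocalRingAt p, toLoc p q ∣ (rc * r).val → toLoc p q ∣ r.val := fun r hr => by
    refine toLoc_dvd_of_dvd_mul hcq.symm ?_
    rw [ec, mul_right_comm, ← HomogeneousLocalization.val_mul]
    exact hr.mul_right _
  have hsplit : ∀ r : LocalRingAt p, r ∈ S → toLoc p c ∣ r.val ∧ toLoc p q ∣ r.val := fun r hr =>
    ⟨(Dvd.intro _ rfl).trans ((hmem r).1 hr), (Dvd.intro_left _ rfl).trans ((hmem r).1 hr)⟩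
  have hjoin : ∀ r : LocalRingAt p, toLoc p c ∣ r.val → toLoc p q ∣ r.val → r ∈ S := by
    rintro r ⟨z, hz⟩ h2
    rw [hmem, hz]
    rw [hz] at h2
    exact mul_dvd_mul_left _ (toLoc_dvd_of_dvd_mul hcq.symm h2)
  have hcdvd : ∀ r : LocalRingAt p, toLoc p c ∣ (rc * r).val := fun r => by
    rw [← hdvd, HomogeneousLocalization.val_mul]; exact Dvd.intro _ rfl
  have hqdvd : ∀ r : LocalRingAt p, toLoc p q ∣ (rq * r).val := fun r => by
    rw [← hdvd', HomogeneousLocalization.val_mul]; exact Dvd.intro _ rfl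
  let π := Ideal.Quotient.mk S
  have hπ : ∀ r, π r = 0 ↔ r ∈ S := fun r => Ideal.Quotient.eq_zero_iff_mem
  -- On each of the two curves `rq + rc` restricts to the equation of the other one, which is not a
  -- zero divisor there.
  have hs : π (rq + rc) ∈ nonZeroDivisors (CurveLocalRing (c * q) p) := by
    rw [mem_nonZeroDivisors_iff_right]
    intro y hy
    obtain ⟨y, rfl⟩ := Ideal.Quotient.mk_surjective y
    rw [← map_mul, hπ] at hy
    obtain ⟨h1, h2⟩ := hsplit _ hy
    rw [show y * (rq + rc) = rq * y + rc * y by ring, HomogeneousLocalization.val_add] at h1 h2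
    exact (hπ y).2 (hjoin y (hcan y ((dvd_add_left (hcdvd y)).1 h1))
      (hcan' y ((dvd_add_right (hqdvd y)).1 h2)))
  have h0 : π rq * π rc = 0 := by
    rw [← map_mul, hπ]
    refine hjoin _ ?_ (hqdvd rc)
    rw [mul_comm]; exact hcdvd rq
  have hra : π ra ∈ conductorIdeal (CurveLocalRing (c * q) p) :=
    h (Ideal.mem_map_of_mem π (show ra ∈ stalkIdeal (Ideal.span {a}) p by
      rw [mem_stalkIdeal, Ideal.map_span, Set.image_singleton, Ideal.mem_span_singleton, ea,
        hua.mul_right_dvd]))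
  rw [map_add] at hs
  obtain ⟨r, hr⟩ := exists_mul_add_eq_of_mem_conductorIdeal h0 hs hra
  obtain ⟨t, rfl⟩ := Ideal.Quotient.mk_surjective r
  have h2 : t * (rq + rc) - ra * rq ∈ S := by
    rw [← hπ, map_sub, map_mul, map_add, map_mul, sub_eq_zero]
    exact hr
  -- Modulo `c` the relation says `q (t - a) = 0`, modulo `q` it says `c t = 0`. Hence `c` divides
  -- `t - a` and `q` divides `t`, so that `a = t - (t - a)` lies in `(q, c)`.
  obtain ⟨h3, h4⟩ := hsplit _ h2
  have h5 : toLoc p c ∣ (t - ra).val := hcan _ (by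
    rw [show t * (rq + rc) - ra * rq = rq * (t - ra) + rc * t by ring,
      HomogeneousLocalization.val_add] at h3
    exact (dvd_add_left (hcdvd t)).1 h3)
  have h6 : toLoc p q ∣ t.val := hcan' _ (by
    rw [show t * (rq + rc) - ra * rq = rq * (t - ra) + rc * t by ring,
      HomogeneousLocalization.val_add] at h4
    exact (dvd_add_right (hqdvd _)).1 h4)
  rw [← toLoc_mem_map, ea, Ideal.map_span, Set.image_pair]
  refine Ideal.mul_mem_right _ _ ?_
  obtain ⟨x, hx⟩ := h5
  obtain ⟨y, hy⟩ := h6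
  rw [HomogeneousLocalization.val_sub] at hx
  exact Ideal.mem_span_pair.2 ⟨y, -x, by linear_combination hx - hy⟩

/-! ### Intersection multiplicities -/

theorem intMult_eq_zero {f g : Poly} {p : Pt} (h : 1 ∈ locIdeal (Ideal.span {f, g}) p) :
    intMult f g p = 0 := by
  have : stalkIdeal (Ideal.span {f, g}) p = ⊤ := by
    rw [Ideal.eq_top_iff_one, mem_stalkIdeal, HomogeneousLocalization.val_one,
      ← map_one (toLoc p)]
    exact h
  rw [intMult, Module.length_eq_zero_iff, this]
  infer_instance

theorem mem_maximalIdeal_iff_val {p : Pt} {r : LocalRingAt p} :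
    r ∈ IsLocalRing.maximalIdeal (LocalRingAt p) ↔ r.val ∈ (ptIdeal p).map (toLoc p) := by
  rw [Localization.AtPrime.map_eq_maximalIdeal, IsLocalRing.mem_maximalIdeal,
    IsLocalRing.mem_maximalIdeal, mem_nonunits_iff, mem_nonunits_iff,
    HomogeneousLocalization.isUnit_iff_isUnit_val]

/-- A criterion for intersection multiplicity two. -/
theorem intMult_eq_two {f g y : Poly} {i j : ℕ} {p : Pt} (hf : f.IsHomogeneous i)
    (hy : y.IsHomogeneous j) (hfp : f ∈ ptIdeal p)
    (hgp : g ∈ ptIdeal p) (hyp : y ∈ ptIdeal p)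
    (h1 : ptIdeal p ≤ locIdeal (Ideal.span {f, y}) p)
    (h2 : ptIdeal p ^ 2 ≤ locIdeal (Ideal.span {f, g}) p)
    (h3 : y ∉ locIdeal (Ideal.span {f, g}) p) : intMult f g p = 2 := by
  set J := stalkIdeal (Ideal.span {f, g}) p with hJ
  set K := IsLocalRing.maximalIdeal (LocalRingAt p)
  obtain ⟨k, hk⟩ := exists_rep_ne_zero p
  have hX := X_notMem_ptIdeal hk j
  have hXh : (X k ^ j : Poly).IsHomogeneous j := by simpa using isHomogeneous_X_pow (R := ℂ) k j
  let z : LocalRingAt p := HomogeneousLocalization.mk ⟨j, ⟨y, hy⟩, ⟨X k ^ j, hXh⟩, hX⟩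
  have hz : z.val * toLoc p (X k ^ j) = toLoc p y := by
    rw [HomogeneousLocalization.val_mk, Localization.mk_eq_mk']
    exact IsLocalization.mk'_spec (PtLoc p) y ⟨X k ^ j, hX⟩
  have hzI : ∀ I : Ideal (PtLoc p), z.val ∈ I ↔ toLoc p y ∈ I := fun I => by
    rw [← hz, Ideal.mul_unit_mem_iff_mem _ (isUnit_toLoc hX)]
  have hJK : J ≤ K := fun r hr => mem_maximalIdeal_iff_val.2
    (Ideal.map_mono (Ideal.span_le.2 (by rintro x (rfl | rfl) <;> assumption)) hr)
  have hKz : ∀ r ∈ K, r * z ∈ J := fun r hr => by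
    rw [hJ, mem_stalkIdeal, HomogeneousLocalization.val_mul]
    have h4 : (ptIdeal p ^ 2).map (toLoc p) ≤ (Ideal.span {f, g}).map (toLoc p) :=
      Ideal.map_le_iff_le_comap.2 h2
    refine h4 ?_
    rw [Ideal.map_pow, sq]
    exact Ideal.mul_mem_mul (mem_maximalIdeal_iff_val.1 hr)
      ((hzI _).2 (Ideal.mem_map_of_mem _ hyp))
  have hzJ : z ∉ J := fun h => h3 (toLoc_mem_map.1 ((hzI _).1 h))
  -- Since `f` and `y` generate the maximal ideal locally, `z` generates it modulo `f`. The
  -- coefficient `s` must be a fraction of degree zero, which is why the denominators and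
  -- coefficients are chosen homogeneous.
  have hgen : ∀ r ∈ K, ∃ s, r - s * z ∈ J := fun r hr => by
    have hd := isUnit_toLoc r.den_mem
    have hr' : toLoc p r.den * r.val = toLoc p r.num := by
      rw [← r.den_smul_val, Algebra.smul_def]
    have hnum : r.num ∈ ptIdeal p := by
      have h5 := mem_maximalIdeal_iff_val.1 hr
      rw [← Ideal.unit_mul_mem_iff_mem _ hd, hr'] at h5
      exact locIdeal_le_ptIdeal le_rfl h5
    obtain ⟨n, w, hw, hwp, hwx⟩ := exists_isHomogeneous_mul_mem (isGradedIdeal_span_pair hf hy)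
      r.num_mem_deg (h1 hnum)
    obtain ⟨a, b, -, hb, e⟩ := exists_homogeneous_eq_add ((hw.mul r.num_mem_deg).mul hXh) hf hy
      (Ideal.mul_mem_right _ _ hwx)
    rw [Nat.add_sub_cancel] at hb
    rw [← mem_ptIdeal_of_isHomogeneous hw] at hwp
    have hwd := mul_notMem_ptIdeal hwp r.den_mem
    let s : LocalRingAt p := HomogeneousLocalization.mk
      ⟨n + r.deg, ⟨b, hb⟩, ⟨w * r.den, hw.mul r.den_mem_deg⟩, hwd⟩
    have hs : s.val * toLoc p (w * r.den) = toLoc p b := by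
      rw [HomogeneousLocalization.val_mk, Localization.mk_eq_mk']
      exact IsLocalization.mk'_spec (PtLoc p) b ⟨w * r.den, hwd⟩
    refine ⟨s, ?_⟩
    rw [hJ, mem_stalkIdeal, HomogeneousLocalization.val_sub, HomogeneousLocalization.val_mul,
      ← Ideal.unit_mul_mem_iff_mem _ (isUnit_toLoc (mul_notMem_ptIdeal hwd hX))]
    have e' := congrArg (toLoc p) e
    simp only [map_mul, map_add] at e' hs hz ⊢
    rw [show toLoc p w * toLoc p r.den * toLoc p (X k ^ j) * (r.val - s.val * z.val) =
      toLoc p a * toLoc p f by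
        linear_combination toLoc p w * toLoc p (X k ^ j) * hr' + e' -
          z.val * toLoc p (X k ^ j) * hs - toLoc p b * hz]
    exact Ideal.mul_mem_left _ _ (Ideal.mem_map_of_mem _ (Ideal.subset_span (by simp)))
  exact length_quotient_eq_two hJK
    (mem_maximalIdeal_iff_val.2 ((hzI _).2 (Ideal.mem_map_of_mem _ hyp))) hzJ hKz hgen

/-! ### Rational sections on plane curves -/

theorem toRat_eq_toRat_iff {F x y : Poly} : toRat F x = toRat F y ↔ F ∣ x - y := by
  rw [toRat, RingHom.comp_apply, RingHom.comp_apply,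
    (IsFractionRing.injective (Poly ⧸ Ideal.span {F}) (RatRing F)).eq_iff,
    Ideal.Quotient.mk_eq_mk_iff_sub_mem, Ideal.mem_span_singleton]

theorem toRat_self (F : Poly) : toRat F F = 0 := by
  rw [← map_zero (toRat F), toRat_eq_toRat_iff, sub_zero]

theorem mk_mem_nonZeroDivisors_iff {F h : Poly} (hF : F ≠ 0) :
    Ideal.Quotient.mk (Ideal.span {F}) h ∈ nonZeroDivisors (Poly ⧸ Ideal.span {F}) ↔
      IsRelPrime h F := by
  rw [mem_nonZeroDivisors_iff_right]
  constructor
  · rintro H g ⟨h', rfl⟩ ⟨F', rfl⟩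
    have h1 := H (Ideal.Quotient.mk _ F') (by
      rw [← map_mul, Ideal.Quotient.eq_zero_iff_mem, Ideal.mem_span_singleton]
      exact Dvd.intro_left h' (by ring))
    rw [Ideal.Quotient.eq_zero_iff_mem, Ideal.mem_span_singleton] at h1
    obtain ⟨k, hk⟩ := h1
    refine IsUnit.of_mul_eq_one k (mul_right_cancel₀ (right_ne_zero_of_mul hF) ?_)
    rw [one_mul]
    linear_combination -hk
  · intro H x hx
    obtain ⟨x, rfl⟩ := Ideal.Quotient.mk_surjective x
    rw [← map_mul, Ideal.Quotient.eq_zero_iff_mem, Ideal.mem_span_singleton] at hx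
    rw [Ideal.Quotient.eq_zero_iff_mem, Ideal.mem_span_singleton]
    exact H.symm.dvd_of_dvd_mul_right hx

theorem isUnit_toRat {F h : Poly}
    (hh : Ideal.Quotient.mk (Ideal.span {F}) h ∈ nonZeroDivisors (Poly ⧸ Ideal.span {F})) :
    IsUnit (toRat F h) :=
  IsLocalization.map_units (RatRing F) (⟨_, hh⟩ : nonZeroDivisors (Poly ⧸ Ideal.span {F}))

/-- A form whose divisor is twice a sum of points gives a linear equivalence. -/
theorem linEquiv_of_form {α G : Poly} {m : ℕ} (hα0 : α ≠ 0) (hG : G.IsHomogeneous m)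
    (hrel : IsRelPrime G α) {D D' : Divisor} (hm : D'.2 - D.2 = m)
    (h : ∀ p, (D'.1 p - D.1 p = 0 ∧ 1 ∈ locIdeal (Ideal.span {α, G}) p) ∨
      (D'.1 p - D.1 p = -2 ∧ G ∈ locIdeal (Ideal.span {α} ⊔ ptIdeal p ^ 2) p ∧
        ptIdeal p ^ 2 ≤ locIdeal (Ideal.span {α, G}) p)) : LinEquiv α D D' := by
  have hn := (mk_mem_nonZeroDivisors_iff hα0).2 hrel
  have h1 : Ideal.Quotient.mk (Ideal.span {α}) 1 ∈ nonZeroDivisors (Poly ⧸ Ideal.span {α}) := by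
    rw [map_one]; exact one_mem _
  obtain ⟨φ, hφ⟩ := isUnit_toRat hn
  have hinv : toRat α G * (φ⁻¹ : (RatRing α)ˣ) = 1 := by rw [← hφ]; exact φ.mul_inv
  have hα : toRat α α = 0 := toRat_self α
  refine ⟨φ, ⟨Or.inr ⟨m, 0, G, 1, hG, isHomogeneous_one _ _, ?_, h1, ?_⟩, fun p => ?_⟩,
    ⟨Or.inr ⟨0, m, 1, G, isHomogeneous_one _ _, hG, ?_, hn, ?_⟩, fun p => ?_⟩⟩
  · rw [Prod.snd_sub, hm]; simp
  · rw [map_one, mul_one, hφ]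
  -- The section is `G` itself. Membership of `G` in `(α) + 𝔪²` says that it has order at least two
  -- on the curve; below, `𝔪² ⊆ (α, G)` says that `1 / G` has a pole of order at most two.
  · rw [Prod.fst_sub, Finsupp.sub_apply, hφ]
    rcases h p with ⟨e, -⟩ | ⟨e, hGp, -⟩
    · rw [e]
      exact ⟨1, one_notMem_ptIdeal p, fun t _ => ⟨t * G, by simp, by simp⟩⟩
    · rw [e]
      obtain ⟨w, hw, hGp⟩ := mem_locIdeal.1 hGp
      obtain ⟨a, ha, b, hb, hab⟩ := Submodule.mem_sup.1 hGp
      obtain ⟨c, rfl⟩ := Ideal.mem_span_singleton.1 ha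
      refine ⟨w, hw, fun t _ => ⟨t * b, Ideal.mul_mem_left _ _ hb, ?_⟩⟩
      rw [← map_mul, toRat_eq_toRat_iff]
      exact ⟨c * t, by linear_combination -t * hab⟩
  · rw [Prod.snd_sub]
    push_cast
    omega
  · rw [mul_comm, hinv, map_one]
  · rw [Prod.fst_sub, Finsupp.sub_apply]
    rcases h p with ⟨e, h2⟩ | ⟨e, -, h2⟩
    · rw [show D.1 p - D'.1 p = 0 by omega]
      obtain ⟨w, hw, h2⟩ := mem_locIdeal.1 h2
      obtain ⟨a, b, hab⟩ := Ideal.mem_span_pair.1 h2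
      refine ⟨w, hw, fun t _ => ⟨b * t, by simp, ?_⟩⟩
      rw [mul_one] at hab
      rw [← hab]
      simp only [map_mul, map_add, hα]
      linear_combination toRat α b * toRat α t * hinv
    · rw [show D.1 p - D'.1 p = 2 by omega]
      obtain ⟨w, hw, h2⟩ := exists_mul_mem_of_le_locIdeal h2
      refine ⟨w, hw, fun t ht => ?_⟩
      obtain ⟨a, b, hab⟩ := Ideal.mem_span_pair.1 (h2 t ht)
      refine ⟨b, by simp, ?_⟩
      rw [← hab]
      simp only [map_mul, map_add, hα]
      linear_combination toRat α b * hinv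

/-- A section of `𝒪(E)`, multiplied by a form that vanishes on the points of `E`, is given by a
form. -/
theorem exists_form_of_mem_globalSections {α Q : Poly} {e q N : ℕ} (hα : α.IsHomogeneous e)
    (hα0 : α ≠ 0) (hQ : Q.IsHomogeneous q) {E : Divisor}
    (hN : (N : ℤ) = q + E.2)
    (hloc : ∀ p, ∃ t t', Q = t * t' ∧ t ∈ ptIdeal p ^ (E.1 p).toNat)
    {φ : RatRing α} (hφ : φ ∈ globalSections α E) :
    ∃ G : Poly, G.IsHomogeneous N ∧ φ * toRat α Q = toRat α G ∧
      ∀ p t t', Q = t * t' → t ∈ ptIdeal p ^ (E.1 p).toNat → t' ∈ ptIdeal p → α ∈ ptIdeal p →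
        G ∈ ptIdeal p := by
  obtain ⟨h1, h2⟩ := hφ
  have hpole : ∀ p, ∃ w ∉ ptIdeal p, ∀ t ∈ ptIdeal p ^ (E.1 p).toNat, ∃ u,
      toRat α (w * t) * φ = toRat α u := fun p => by
    obtain ⟨w, hw, H⟩ := h2 p
    refine ⟨w, hw, fun t ht => ?_⟩
    obtain ⟨u, -, hu⟩ := H t ht
    exact ⟨u, hu⟩
  rcases h1 with rfl | ⟨a, b, g, h, hg, hh, hab, hn, hφh⟩
  · exact ⟨0, isHomogeneous_zero _ _ _, by simp, fun p _ _ _ _ _ _ => zero_mem _⟩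
  -- `φ Q` is regular at every point, so its numerator lies locally in `(h, α)`; Max Noether's
  -- theorem then replaces the quotient `g Q / h` by a form on the curve.
  have hspan : g * Q ∈ Ideal.span {h, α} := by
    refine mem_span_of_forall_mem_locIdeal ((mk_mem_nonZeroDivisors_iff hα0).1 hn) hα0 hh hα
      (hg.mul hQ) fun p => ?_
    obtain ⟨w, hw, H⟩ := hpole p
    obtain ⟨t, t', hQt, ht⟩ := hloc p
    obtain ⟨u, hu⟩ := H t ht
    have h3 : toRat α (w * (g * Q)) = toRat α (u * t' * h) := by
      rw [hQt]
      simp only [map_mul] at hu ⊢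
      linear_combination toRat α t' * toRat α h * hu -
        toRat α w * toRat α t * toRat α t' * hφh
    rw [toRat_eq_toRat_iff] at h3
    obtain ⟨c, hc⟩ := h3
    exact mem_locIdeal.2 ⟨w, hw, Ideal.mem_span_pair.2 ⟨u * t', c, by linear_combination -hc⟩⟩
  obtain ⟨G, s, hG, -, hGs⟩ := exists_homogeneous_eq_add (hg.mul hQ) hh hα hspan
  rw [show a + q - b = N by omega] at hG
  have hφG : φ * toRat α Q = toRat α G := by
    refine (isUnit_toRat hn).mul_right_cancel ?_
    have h3 := congrArg (toRat α) hGs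
    simp only [map_mul, map_add, toRat_self] at h3
    linear_combination toRat α Q * hφh + h3
  refine ⟨G, hG, hφG, fun p t t' hQt ht ht' hαp => ?_⟩
  obtain ⟨w, hw, H⟩ := hpole p
  obtain ⟨u, hu⟩ := H t ht
  -- The factor `t` absorbs the pole of `φ`, and the remaining factor `t'` still vanishes at `p`.
  have h3 : toRat α (w * G) = toRat α (u * t') := by
    rw [hQt] at hφG
    simp only [map_mul] at hu hφG ⊢
    linear_combination toRat α t' * hu - toRat α w * hφG
  rw [toRat_eq_toRat_iff] at h3
  obtain ⟨c, hc⟩ := h3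
  have h4 : w * G ∈ ptIdeal p := by
    rw [show w * G = u * t' + α * c by linear_combination hc]
    exact add_mem (Ideal.mul_mem_left _ _ ht') (Ideal.mul_mem_right _ _ hαp)
  exact ((ptIdeal_isPrime p).mem_or_mem h4).resolve_left hw

theorem h0_eq_zero_of_forall {F : Poly} {D : Divisor} (h : ∀ φ ∈ globalSections F D, φ = 0) :
    h0 F D = 0 := by
  rw [h0, (Submodule.eq_bot_iff _).2 h]
  exact rank_bot ℂ _

/-! ### Transversality, nodes and common components -/

theorem TransversalAt.symm {f g : Poly} {p : Pt} (h : TransversalAt f g p) :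
    TransversalAt g f p := by
  refine ⟨h.2.1, h.1, ?_⟩
  rw [LinearIndependent.pair_symm_iff]
  exact h.2.2

theorem TransversalAt.mul_left {f g r : Poly} {p : Pt} (h : TransversalAt f g p)
    (hr : ¬ VanishesAt r p) : TransversalAt (f * r) g p := by
  refine ⟨vanishesAt_mul.2 (Or.inl h.1), h.2.1, ?_⟩
  rw [grad_mul, show eval p.rep f = 0 from h.1, zero_smul, zero_add]
  have h3 := h.2.2
  rw [LinearIndependent.pair_iff] at h3 ⊢
  intro s t e
  obtain ⟨h1, h2⟩ := h3 (s * eval p.rep r) t (by rw [mul_smul]; exact e)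
  exact ⟨(mul_eq_zero.1 h1).resolve_right hr, h2⟩

theorem mem_singularSet_mul {f g : Poly} {p : Pt} (hf : VanishesAt f p) (hg : VanishesAt g p) :
    p ∈ singularSet (f * g) := by
  refine ⟨vanishesAt_mul.2 (Or.inl hf), ?_⟩
  rw [grad_mul, show eval p.rep f = 0 from hf, show eval p.rep g = 0 from hg, zero_smul, zero_smul,
    add_zero]

theorem hessian_mul_mul {f g : Poly} (h : Poly) {p : Pt} (hf : VanishesAt f p)
    (hg : VanishesAt g p) : hessian (f * g * h) p = eval p.rep h •
      (Matrix.vecMulVec (grad f p) (grad g p) + Matrix.vecMulVec (grad g p) (grad f p)) := by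
  unfold VanishesAt at hf hg
  ext j k
  simp only [hessian, Matrix.of_apply, Derivation.leibniz, smul_eq_mul, map_add, map_mul,
    hf, hg, Matrix.smul_apply, Matrix.add_apply, Matrix.vecMulVec_apply, grad]
  ring

/-- At a common zero of `f` and `g` the Hessian of `f g h` is `h(p)` times the symmetrized product
of the gradients; its rank is at most one if `h(p) = 0` or the gradients are dependent. -/
theorem IsNode.transversal {f g h : Poly} {p : Pt} (hn : IsNode (f * g * h) p)
    (hf : VanishesAt f p) (hg : VanishesAt g p) : ¬ VanishesAt h p ∧ TransversalAt f g p := by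
  have hr := hn.2
  rw [hessian_mul_mul h hf hg] at hr
  refine ⟨fun h0 => ?_, hf, hg, ?_⟩
  · rw [show eval p.rep h = 0 from h0, zero_smul, Matrix.rank_zero] at hr
    omega
  · rw [LinearIndependent.pair_iff]
    intro s t e
    by_contra hst
    have key : ∀ u : Fin 3 → ℂ, ∀ a b : ℂ, eval p.rep h • (Matrix.vecMulVec (a • u) (b • u) +
        Matrix.vecMulVec (b • u) (a • u)) = Matrix.vecMulVec ((eval p.rep h * (2 * a * b)) • u) u :=
      fun u a b => by
        ext j k
        simp [Matrix.vecMulVec_apply]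
        ring
    have hu : ∃ (u : Fin 3 → ℂ) (a b : ℂ), grad f p = a • u ∧ grad g p = b • u := by
      by_cases hs : s = 0
      · subst hs
        have ht : t ≠ 0 := fun ht => hst ⟨rfl, ht⟩
        rw [zero_smul, zero_add, smul_eq_zero, or_iff_right ht] at e
        exact ⟨grad f p, 1, 0, by rw [one_smul], by rw [e, zero_smul]⟩
      · refine ⟨grad g p, -s⁻¹ * t, 1, ?_, by rw [one_smul]⟩
        rw [mul_smul, neg_smul, ← smul_neg, ← eq_neg_of_add_eq_zero_left e, smul_smul,
          inv_mul_cancel₀ hs, one_smul]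
    obtain ⟨u, a, b, ha, hb⟩ := hu
    rw [ha, hb, key] at hr
    have := Matrix.rank_vecMulVec_le ((eval p.rep h * (2 * a * b)) • u) u
    omega

/-- If `g` had no zero except possibly the origin, the Nullstellensatz would make it divide powers
of `X 0` and `X 1`, hence be a unit. -/
theorem exists_eval_eq_zero {g : Poly} (hg : ¬ IsUnit g) : ∃ v : Fin 3 → ℂ, v ≠ 0 ∧ eval v g = 0 := by
  by_contra! H
  have key : ∀ i : Fin 3, ∃ N : ℕ, g ∣ X i ^ N := fun i => by
    have : (X i : Poly) ∈ (Ideal.span {g}).radical := by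
      rw [← vanishingIdeal_zeroLocus_eq_radical (K := ℂ), mem_vanishingIdeal_iff]
      intro v hv
      have := mem_zeroLocus_iff.1 hv g (Ideal.mem_span_singleton_self g)
      rw [aeval_eq_eval] at this
      by_cases hv0 : v = 0
      · rw [hv0, aeval_X]; rfl
      · exact absurd this (H v hv0)
    obtain ⟨N, hN⟩ := this
    exact ⟨N, Ideal.mem_span_singleton.1 hN⟩
  obtain ⟨a, ha⟩ := key 0
  obtain ⟨b, hb⟩ := key 1
  exact hg (isRelPrime_X_pow (by decide) a b ha hb)

/-- Forms that meet transversally have no common factor. -/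
theorem isRelPrime_of_forall_linearIndependent {f g : Poly} {m n : ℕ} (hf : f.IsHomogeneous m)
    (hg : g.IsHomogeneous n) (h : ∀ p, VanishesAt f p → VanishesAt g p →
      LinearIndependent ℂ ![grad f p, grad g p]) : IsRelPrime f g := by
  rintro d ⟨f', rfl⟩ ⟨g', rfl⟩
  by_contra hd
  obtain ⟨v, hv0, hv⟩ := exists_eval_eq_zero hd
  set p : Pt := Projectivization.mk ℂ v hv0
  obtain ⟨c, hc⟩ := Projectivization.exists_smul_eq_mk_rep ℂ v hv0
  have hrep : p.rep = (c : ℂ) • v := by rw [← hc]; rfl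
  have hvan : ∀ {k : ℕ} {r : Poly}, (d * r).IsHomogeneous k → VanishesAt (d * r) p := fun hr => by
    rw [VanishesAt, hrep, eval_smul_of_isHomogeneous hr, map_mul, hv, zero_mul, mul_zero]
  -- Both gradients are multiples of that of the common factor `d`. As `d` is not known to be
  -- homogeneous, its gradient is taken at `v`, and only the products are rescaled to the
  -- representative of `p`.
  have hgrad : ∀ {k : ℕ} {r : Poly}, (d * r).IsHomogeneous k → ∃ a : ℂ,
      grad (d * r) p = a • fun j => eval v (pderiv j d) := fun {k r} hr => by
    refine ⟨(c : ℂ) ^ (k - 1) * eval v r, ?_⟩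
    ext j
    rw [grad, hrep, eval_smul_of_isHomogeneous hr.pderiv, Derivation.leibniz]
    simp [hv]
    ring
  obtain ⟨a, ha⟩ := hgrad hf
  obtain ⟨b, hb⟩ := hgrad hg
  have hli := h p (hvan hf) (hvan hg)
  rw [ha, hb, LinearIndependent.pair_iff] at hli
  obtain ⟨h1, h2⟩ := hli b (-a) (by module)
  rw [neg_eq_zero] at h2
  rw [h1, h2] at hli
  simpa using hli 1 1

/-- Two curves have finitely many transversal intersection points. -/
theorem finite_setOf_transversalAt {f g : Poly} {m n : ℕ} (hf : f.IsHomogeneous m)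
    (hg : g.IsHomogeneous n) : {p | TransversalAt f g p}.Finite := by
  -- At a transversal intersection `f` and `g` generate the ideal of the point locally, which is
  -- therefore a minimal prime over `(f, g)`; a Noetherian ring has only finitely many of these.
  refine Set.Finite.of_finite_image (f := ptIdeal)
    ((Ideal.finite_minimalPrimes_of_isNoetherianRing Poly (Ideal.span {f, g})).subset ?_) ?_
  · rintro _ ⟨p, hp, rfl⟩
    have hfp := (mem_ptIdeal_of_isHomogeneous hf).2 hp.1
    have hgp := (mem_ptIdeal_of_isHomogeneous hg).2 hp.2.1
    obtain ⟨w, hw, H⟩ := exists_mul_mem_span_of_transversalAt hfp hgp hp.2.2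
    refine ⟨⟨ptIdeal_isPrime p, Ideal.span_le.2 ?_⟩, ?_⟩
    · rintro x (rfl | rfl) <;> assumption
    · rintro q ⟨hq, hle⟩ hqp x hx
      exact (hq.mem_or_mem (hle (H x hx))).resolve_left fun h => hw (hqp h)
  · intro p _ q _ h
    rw [← p.mk_rep, ← q.mk_rep, Projectivization.mk_eq_mk_iff']
    obtain ⟨k, hk⟩ := exists_rep_ne_zero q
    refine ⟨p.rep k / q.rep k, funext fun i => ?_⟩
    have h1 : (C (q.rep k) * X i - C (q.rep i) * X k : Poly) ∈ ptIdeal p := by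
      rw [h, mem_ptIdeal_of_isHomogeneous ((isHomogeneous_C_mul_X _ _).sub
        (isHomogeneous_C_mul_X _ _))]
      simp [VanishesAt, mul_comm]
    have h2 := vanishesAt_of_mem_ptIdeal h1
    simp only [VanishesAt, map_sub, map_mul, eval_C, eval_X] at h2
    rw [Pi.smul_apply, smul_eq_mul, div_mul_eq_mul_div, div_eq_iff hk]
    linear_combination -h2

theorem grad_ne_zero_of_isHomogeneous_one {l : Poly} (hl : l.IsHomogeneous 1) (h0 : l ≠ 0)
    (p : Pt) : grad l p ≠ 0 := by
  intro h
  apply h0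
  rw [← one_smul ℕ l, ← hl.sum_X_mul_pderiv]
  refine Finset.sum_eq_zero fun i _ => ?_
  obtain ⟨c, hc⟩ := exists_eq_C (hl.pderiv (i := i))
  have h1 := congrFun h i
  rw [grad, hc, eval_C, Pi.zero_apply] at h1
  rw [hc, h1, map_zero, mul_zero]

/-- The line through two points. -/
theorem exists_line {u w : Pt} (h : u ≠ w) : ∃ l : Poly, l.IsHomogeneous 1 ∧ l ≠ 0 ∧
    VanishesAt l u ∧ VanishesAt l w := by
  set a := crossProduct u.rep w.rep with ha
  have ha0 : a ≠ 0 := by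
    rw [ha, crossProduct_ne_zero_iff_linearIndependent, LinearIndependent.pair_iff' u.rep_nonzero]
    intro c hc
    apply h
    rw [← u.mk_rep, ← w.mk_rep, eq_comm, Projectivization.mk_eq_mk_iff']
    exact ⟨c, hc⟩
  have heval : ∀ v : Fin 3 → ℂ, eval v (∑ i, C (a i) * X i) = v ⬝ᵥ a := fun v => by
    simp [dotProduct, mul_comm]
  refine ⟨∑ i, C (a i) * X i, IsHomogeneous.sum _ _ _ fun i _ => isHomogeneous_C_mul_X _ _,
    fun h0 => ha0 (funext fun i => ?_), ?_, ?_⟩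
  · have := heval (Pi.single i 1)
    rw [h0, map_zero, single_dotProduct, one_mul] at this
    exact this.symm
  · rw [VanishesAt, heval, ha, dot_self_cross]
  · rw [VanishesAt, heval, ha, dot_cross_self]

/-- Through every point of a line passes another line. -/
theorem exists_other_line {c : Poly} (hc : c.IsHomogeneous 1) (hc0 : c ≠ 0) {u : Pt}
    (hu : VanishesAt c u) : ∃ l : Poly, l.IsHomogeneous 1 ∧ VanishesAt l u ∧ IsRelPrime l c := by
  obtain ⟨v, hv⟩ : ∃ v, eval v c ≠ 0 := by
    by_contra! H
    exact hc0 (MvPolynomial.funext fun v => by rw [H, map_zero])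
  have hv0 : v ≠ 0 := by
    rintro rfl
    have := eval_smul_of_isHomogeneous hc 0 0
    rw [zero_smul, pow_one, zero_mul] at this
    exact hv this
  have hw : ¬ VanishesAt c (Projectivization.mk ℂ v hv0) := by
    obtain ⟨t, ht⟩ := Projectivization.exists_smul_eq_mk_rep ℂ v hv0
    rw [VanishesAt, ← ht, Units.smul_def, eval_smul_of_isHomogeneous hc, pow_one]
    exact mul_ne_zero t.ne_zero hv
  obtain ⟨l, hl, hl0, hlu, hlw⟩ := exists_line (u := u) (w := Projectivization.mk ℂ v hv0)
    (by rintro rfl; exact hw hu)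
  refine ⟨l, hl, hlu, IsRelPrime.symm ?_⟩
  rw [(irreducible_of_isHomogeneous_one hc hc0).isRelPrime_iff_not_dvd]
  intro hdvd
  obtain ⟨κ, rfl⟩ := exists_eq_C_mul hl hc hdvd
  rw [vanishesAt_mul, or_iff_left hw] at hlw
  rw [VanishesAt, eval_C] at hlw
  rw [hlw, map_zero, zero_mul] at hl0
  exact hl0 rfl

/-! ### Curves touching at a point -/

theorem grad_eq_zero_of_mem_sq {q : Poly} {p : Pt} (hq : q ∈ ptIdeal p ^ 2) : grad q p = 0 := by
  rw [sq] at hq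
  refine Submodule.mul_induction_on hq (fun x hx y hy => ?_) fun x y h1 h2 => ?_
  · exact (mem_singularSet_mul (vanishesAt_of_mem_ptIdeal hx) (vanishesAt_of_mem_ptIdeal hy)).2
  · rw [grad_add, h1, h2, add_zero]

/-- If `α` is transversal to `f` and `g` at `p` and `G` agrees with `f g` along `α` up to a unit,
then `G` meets `α` in `p` with multiplicity two. -/
theorem sq_le_and_intMult_eq_two {α f g G : Poly} {d e : ℕ} {p : Pt} (hα : α.IsHomogeneous d)
    (hf : f.IsHomogeneous e) (hαp : α ∈ ptIdeal p) (hfp : f ∈ ptIdeal p)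
    (hgp : g ∈ ptIdeal p) (hαf : LinearIndependent ℂ ![grad α p, grad f p])
    (hαg : LinearIndependent ℂ ![grad α p, grad g p])
    (h1 : f * g ∈ locIdeal (Ideal.span {α, G}) p)
    (h2 : G ∈ locIdeal (Ideal.span {α} ⊔ ptIdeal p ^ 2) p) :
    ptIdeal p ^ 2 ≤ locIdeal (Ideal.span {α, G}) p ∧ intMult α G p = 2 := by
  have hmf := ptIdeal_le_locIdeal_of_transversalAt hαp hfp hαf
  have hmg := ptIdeal_le_locIdeal_of_transversalAt hαp hgp hαg
  -- Locally `𝔪 = (α, f) = (α, g)`, hence `𝔪² ⊆ (α, f g) ⊆ (α, G)`.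
  have hsq : ptIdeal p ^ 2 ≤ locIdeal (Ideal.span {α, G}) p := by
    rw [sq, Ideal.mul_le]
    intro r hr s hs
    obtain ⟨w, hw, hr⟩ := mem_locIdeal.1 (hmf hr)
    obtain ⟨w', hw', hs⟩ := mem_locIdeal.1 (hmg hs)
    obtain ⟨a, b, hab⟩ := Ideal.mem_span_pair.1 hr
    obtain ⟨a', b', hab'⟩ := Ideal.mem_span_pair.1 hs
    refine mem_locIdeal_of_mul_mem (mul_notMem_ptIdeal hw hw') ?_
    rw [show w * w' * (r * s) = (a * w' * s + b * f * a') * α + b * b' * (f * g) by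
      linear_combination -(w' * s) * hab - b * f * hab']
    exact add_mem (Ideal.mul_mem_left _ _ (le_locIdeal _ _ (Ideal.subset_span (by simp))))
      (Ideal.mul_mem_left _ _ h1)
  have hle : Ideal.span {α, G} ≤ locIdeal (Ideal.span {α} ⊔ ptIdeal p ^ 2) p := by
    rw [Ideal.span_le]
    rintro x (rfl | rfl)
    · exact le_locIdeal _ _ (Ideal.mem_sup_left (Ideal.mem_span_singleton_self _))
    · exact h2
  have hGp : G ∈ ptIdeal p := locIdeal_le_ptIdeal
    (sup_le ((Ideal.span_singleton_le_iff_mem _).2 hαp) (Ideal.pow_le_self two_ne_zero)) h2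
  -- `f` is a local parameter on the curve. It is not in `(α, G) ⊆ (α) + 𝔪²`, since its gradient
  -- would then be a multiple of that of `α`.
  refine ⟨hsq, intMult_eq_two hα hf hαp hGp hfp hmf hsq fun hf' => ?_⟩
  have hgr : IsGradedIdeal (Ideal.span {α} ⊔ ptIdeal p ^ 2) := by
    rw [sq]
    exact (isGradedIdeal_span (by rintro x rfl; exact ⟨d, hα⟩)).sup
      ((isGradedIdeal_ptIdeal p).mul (isGradedIdeal_ptIdeal p))
  obtain ⟨k, w, -, hwp, hwf⟩ := exists_isHomogeneous_mul_mem hgr hf (locIdeal_le_locIdeal hle hf')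
  obtain ⟨a, ha, q, hq, haq⟩ := Submodule.mem_sup.1 hwf
  obtain ⟨b, rfl⟩ := Ideal.mem_span_singleton.1 ha
  have hgq : grad q p = 0 := grad_eq_zero_of_mem_sq hq
  have hg := congrArg (fun x => grad x p) haq
  have hα' := vanishesAt_of_mem_ptIdeal hαp
  have hf'' := vanishesAt_of_mem_ptIdeal hfp
  unfold VanishesAt at hα' hf''
  simp only [grad_add, grad_mul, hgq, hα', hf'', zero_smul, zero_add, add_zero] at hg
  rw [LinearIndependent.pair_iff] at hαf
  have := (hαf (eval p.rep b) (-eval p.rep w) (by rw [hg]; module)).2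
  exact hwp (neg_eq_zero.1 this)

end PlaneCurve

/-! ### Adjoints on the boundary components of a polycon -/

namespace PolyconData

variable {n : ℕ}

/-! ### Crossings of boundary components -/

/-- The product of all boundary components but one. -/
def cofactor (P : PolyconData n) (j : Fin n) : Poly := ∏ k ∈ Finset.univ.erase j, P.c k

/-- `p` is a transversal intersection point of two components that lies on no other component. -/
structure Crossing (P : PolyconData n) (p : Pt) (j k : Fin n) : Prop where
  ne : j ≠ k
  transversal : TransversalAt (P.c j) (P.c k) p
  other : ∀ m, m ≠ j → m ≠ k → ¬ VanishesAt (P.c m) p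

/-- The boundary components have pairwise no common component. -/
def PairwiseCoprime (P : PolyconData n) : Prop := ∀ j k, j ≠ k → IsRelPrime (P.c j) (P.c k)

/-- The form `a` satisfies the adjoint condition on every boundary component. -/
def IsLocalAdjoint (P : PolyconData n) (a : Poly) : Prop :=
  ∀ j, ∀ p ∈ P.residual, a ∈ locIdeal (Ideal.span {P.cofactor j, P.c j}) p

/-- `s` is a form of degree `3 - deg (C j)` through the explicit vertices on `C j`, without common
component with `C j`. -/
structure IsVertexForm [NeZero n] (P : PolyconData n) (j : Fin n) (s : Poly) : Prop where
  homogeneous : s.IsHomogeneous (3 - (P.c j).totalDegree)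
  left : VanishesAt s (P.v (j - 1))
  right : VanishesAt s (P.v j)
  coprime : IsRelPrime s (P.c j)

variable {P : PolyconData n}

theorem Crossing.symm {p : Pt} {j k : Fin n} (h : P.Crossing p j k) : P.Crossing p k j :=
  ⟨h.ne.symm, h.transversal.symm, fun m h1 h2 => h.other m h2 h1⟩

theorem boundary_eq (P : PolyconData n) (j : Fin n) : P.boundary = P.c j * P.cofactor j :=
  (Finset.mul_prod_erase _ _ (Finset.mem_univ j)).symm

/-- At a crossing, a product of boundary components that involves both branches is their product,
up to a unit. -/
theorem Crossing.prod_eq {p : Pt} {j k : Fin n} (h : P.Crossing p j k) {S : Finset (Fin n)}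
    (hj : j ∈ S) (hk : k ∈ S) :
    ∃ r, ∏ m ∈ S, P.c m = P.c j * P.c k * r ∧ ¬ VanishesAt r p := by
  refine ⟨∏ m ∈ (S.erase j).erase k, P.c m, ?_, ?_⟩
  · rw [mul_assoc, Finset.mul_prod_erase _ _ (Finset.mem_erase.2 ⟨h.ne.symm, hk⟩),
      Finset.mul_prod_erase _ _ hj]
  · rw [vanishesAt_prod]
    rintro ⟨m, hm, hv⟩
    rw [Finset.mem_erase, Finset.mem_erase] at hm
    exact h.other m hm.2.1 hm.1 hv

theorem Crossing.cofactor_eq {p : Pt} {j k : Fin n} (h : P.Crossing p j k) :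
    ∃ r, P.cofactor j = P.c k * r ∧ ¬ VanishesAt r p := by
  refine ⟨∏ m ∈ (Finset.univ.erase j).erase k, P.c m, ?_, ?_⟩
  · rw [Finset.mul_prod_erase _ _ (Finset.mem_erase.2 ⟨h.ne.symm, Finset.mem_univ k⟩), cofactor]
  · rw [vanishesAt_prod]
    rintro ⟨m, hm, hv⟩
    rw [Finset.mem_erase, Finset.mem_erase] at hm
    exact h.other m hm.2.1 hm.1 hv

theorem Crossing.transversal_cofactor {p : Pt} {j k : Fin n} (h : P.Crossing p j k) :
    TransversalAt (P.cofactor j) (P.c j) p := by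
  obtain ⟨r, hr, hrp⟩ := h.cofactor_eq
  rw [hr]
  exact h.symm.transversal.mul_left hrp

theorem exists_ne_vanishesAt {j : Fin n} {p : Pt} (h : VanishesAt (P.cofactor j) p) :
    ∃ k, k ≠ j ∧ VanishesAt (P.c k) p := by
  obtain ⟨k, hk, h⟩ := vanishesAt_prod.1 h
  exact ⟨k, Finset.ne_of_mem_erase hk, h⟩

theorem mem_residual_iff {p : Pt} : p ∈ P.residual ↔ p ∈ singularSet P.boundary ∧
    (∀ m, P.v m ≠ p) ∧ ∀ m, p ∉ singularSet (P.c m) := by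
  simp only [residual, vertices, Set.mem_sdiff, Set.mem_union, Set.mem_range, Set.mem_iUnion,
    not_or, not_exists]

/-- A residual point on a component lies on another component. -/
theorem vanishesAt_cofactor_of_mem_residual {j : Fin n} {p : Pt} (hp : p ∈ P.residual)
    (hj : VanishesAt (P.c j) p) : VanishesAt (P.cofactor j) p := by
  obtain ⟨h1, -, h3⟩ := mem_residual_iff.1 hp
  by_contra h0
  have hg := h1.2
  rw [P.boundary_eq j, grad_mul, show eval p.rep (P.c j) = 0 from hj, zero_smul, zero_add,
    smul_eq_zero] at hg
  exact h3 j ⟨hj, hg.resolve_left h0⟩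

theorem exists_ne_vanishesAt_of_mem_residual {p : Pt} (hp : p ∈ P.residual) :
    ∃ j k, j ≠ k ∧ VanishesAt (P.c j) p ∧ VanishesAt (P.c k) p := by
  obtain ⟨j, -, hj⟩ := vanishesAt_prod.1 hp.1.1
  obtain ⟨k, hk, hk'⟩ := exists_ne_vanishesAt (vanishesAt_cofactor_of_mem_residual hp hj)
  exact ⟨j, k, hk.symm, hj, hk'⟩

theorem degree_eq_add (P : PolyconData n) (j : Fin n) :
    P.degree = (P.c j).totalDegree + ∑ k ∈ Finset.univ.erase j, (P.c k).totalDegree :=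
  (Finset.add_sum_erase _ (fun k => (P.c k).totalDegree) (Finset.mem_univ j)).symm

theorem PairwiseCoprime.cofactor (h : P.PairwiseCoprime) (j : Fin n) :
    IsRelPrime (P.c j) (P.cofactor j) :=
  IsRelPrime.prod_right fun k hk => h j k (Finset.ne_of_mem_erase hk).symm

variable [NeZero n]

theorem IsPolycon.mem_ptIdeal (hP : P.IsPolycon) {j : Fin n} {p : Pt} :
    P.c j ∈ ptIdeal p ↔ VanishesAt (P.c j) p :=
  mem_ptIdeal_of_isHomogeneous (hP.homogeneous j)

theorem IsPolycon.ne_zero (hP : P.IsPolycon) (j : Fin n) : P.c j ≠ 0 := by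
  intro h
  have := hP.degree_eq j
  rw [h, totalDegree_zero] at this
  omega

theorem IsPolycon.isHomogeneous_boundary (hP : P.IsPolycon) :
    P.boundary.IsHomogeneous P.degree :=
  IsHomogeneous.prod _ _ _ fun j _ => hP.homogeneous j

theorem IsPolycon.isHomogeneous_cofactor (hP : P.IsPolycon) (j : Fin n) :
    (P.cofactor j).IsHomogeneous (P.degree - (P.c j).totalDegree) := by
  rw [P.degree_eq_add j, Nat.add_sub_cancel_left]
  exact IsHomogeneous.prod _ _ _ fun k _ => hP.homogeneous k

theorem IsPolycon.add_one_ne (hP : P.IsPolycon) (m : Fin n) : m + 1 ≠ m := by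
  have := hP.two_le
  rw [Ne, add_eq_left, Fin.ext_iff, Fin.val_zero, Fin.val_one', Nat.mod_eq_of_lt this]
  omega

theorem IsPolycon.crossing (hP : P.IsPolycon) (m : Fin n) : P.Crossing (P.v m) m (m + 1) :=
  ⟨(hP.add_one_ne m).symm, hP.transversal m, hP.other m⟩

theorem IsPolycon.isLocalAdjoint (hP : P.IsPolycon) (hco : P.PairwiseCoprime) {a : Poly}
    (ha : P.IsAdjoint a) : P.IsLocalAdjoint a := fun j p hp =>
  mem_locIdeal_of_inConductorAt (hP.homogeneous j) (hP.isHomogeneous_cofactor j) ha.2.1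
    (hco.cofactor j) (by rw [← P.boundary_eq j]; exact ha.2.2 p hp)

/-- On a line, take one further line through each of the two vertices; on a conic, take the line
joining them, which is no component of the conic by the condition on singular conics. -/
theorem IsPolycon.exists_isVertexForm (hP : P.IsPolycon) (j : Fin n) :
    ∃ s, P.IsVertexForm j s := by
  have hl : VanishesAt (P.c j) (P.v (j - 1)) := by
    have := (hP.transversal (j - 1)).2.1
    rwa [sub_add_cancel] at this
  have hr : VanishesAt (P.c j) (P.v j) := (hP.transversal j).1
  rcases hP.degree_eq j with h | h
  · have hc := hP.homogeneous j
    rw [h] at hc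
    obtain ⟨l, hl1, hlu, hlc⟩ := exists_other_line hc (hP.ne_zero j) hl
    obtain ⟨l', hl1', hlu', hlc'⟩ := exists_other_line hc (hP.ne_zero j) hr
    refine ⟨l * l', by rw [h]; exact hl1.mul hl1', vanishesAt_mul.2 (Or.inl hlu),
      vanishesAt_mul.2 (Or.inr hlu'), IsRelPrime.mul_left hlc hlc'⟩
  · have hne : P.v (j - 1) ≠ P.v j := fun e => by
      have h1 := hP.add_one_ne (j - 1)
      rw [sub_add_cancel] at h1
      exact h1 (hP.injective e).symm
    obtain ⟨l, hl1, hl0, hlu, hlw⟩ := exists_line hne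
    refine ⟨l, by rw [h]; exact hl1, hlu, hlw, ?_⟩
    rw [(irreducible_of_isHomogeneous_one hl1 hl0).isRelPrime_iff_not_dvd]
    exact fun hd => hP.split j h l hl1 hd ⟨hlu, hlw⟩

/-! ### Adjoint forms on the boundary components -/

/-- A common zero of a component and its cofactor is an explicit vertex of this component or a
residual point. -/
theorem IsPolycon.mem_residual_or (hP : P.IsPolycon) {j : Fin n} {p : Pt}
    (hj : VanishesAt (P.c j) p) (hQ : VanishesAt (P.cofactor j) p) :
    p ∈ P.residual ∨ ∃ m, p = P.v m ∧ (j = m ∨ j = m + 1) := by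
  obtain ⟨k, hkj, hk⟩ := exists_ne_vanishesAt hQ
  by_cases hv : ∃ m, P.v m = p
  · obtain ⟨m, rfl⟩ := hv
    refine Or.inr ⟨m, rfl, ?_⟩
    by_contra! hjm
    exact hP.other m j hjm.1 hjm.2 hj
  · push Not at hv
    refine Or.inl (mem_residual_iff.2 ⟨?_, hv, fun m hm => ?_⟩)
    · rw [P.boundary_eq j]
      exact mem_singularSet_mul hj hQ
    · by_cases hmj : j = m
      · subst hmj
        exact hP.implicit _ _ hkj p hm hk
      · exact hP.implicit m j hmj p hm hj

/-- The common zeros of `C_j` and its cofactor are residual points, where `a` satisfies the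
condition, and explicit vertices, where the two generate the maximal ideal and `s` vanishes.
Elsewhere the ideal is locally trivial. -/
theorem IsPolycon.mul_mem_locIdeal (hP : P.IsPolycon) {a s : Poly} {j : Fin n}
    (ha : P.IsLocalAdjoint a) (hs : P.IsVertexForm j s) (p : Pt) :
    a * s ∈ locIdeal (Ideal.span {P.cofactor j, P.c j}) p := by
  by_cases hj : VanishesAt (P.c j) p
  swap
  · exact mem_locIdeal_of_notMem (mt hP.mem_ptIdeal.1 hj) (Ideal.subset_span (by simp)) _
  have hQm := mem_ptIdeal_of_isHomogeneous (hP.isHomogeneous_cofactor j) (p := p)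
  by_cases hQ : VanishesAt (P.cofactor j) p
  swap
  · exact mem_locIdeal_of_notMem (mt hQm.1 hQ) (Ideal.subset_span (by simp)) _
  rcases hP.mem_residual_or hj hQ with hr | ⟨m, rfl, hm⟩
  · exact Ideal.mul_mem_right _ _ (ha j p hr)
  · have hsm : s ∈ ptIdeal (P.v m) := by
      rw [mem_ptIdeal_of_isHomogeneous hs.homogeneous]
      rcases hm with rfl | rfl
      · exact hs.right
      · have := hs.left
        rwa [add_sub_cancel_right] at this
    have ht : TransversalAt (P.cofactor j) (P.c j) (P.v m) := by
      rcases hm with rfl | rfl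
      · exact (hP.crossing _).transversal_cofactor
      · exact (hP.crossing m).symm.transversal_cofactor
    exact Ideal.mul_mem_left _ _ (ptIdeal_le_locIdeal_of_transversalAt (hQm.2 hQ)
      (hP.mem_ptIdeal.2 hj) ht.2.2 hsm)

/-- On a boundary component, an adjoint is a multiple of the product of the other components. -/
theorem IsPolycon.exists_mul_eq (hP : P.IsPolycon) (hco : P.PairwiseCoprime)
    (hd : 3 ≤ P.degree) {a s : Poly} {j : Fin n} (hah : a.IsHomogeneous (P.degree - 3))
    (ha : P.IsLocalAdjoint a) (hs : P.IsVertexForm j s) :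
    ∃ (κ : ℂ) (t : Poly), t.IsHomogeneous (P.degree - 2 * (P.c j).totalDegree) ∧
      a * s = C κ * P.cofactor j + t * P.c j := by
  have hQ := hP.isHomogeneous_cofactor j
  have has := hah.mul hs.homogeneous
  have hdeg := P.degree_eq_add j
  have hj := hP.degree_eq j
  rw [show P.degree - 3 + (3 - (P.c j).totalDegree) = P.degree - (P.c j).totalDegree by omega]
    at has
  obtain ⟨x, t, hx, ht, e⟩ := exists_homogeneous_eq_add has hQ (hP.homogeneous j)
    (mem_span_of_forall_mem_locIdeal (hco.cofactor j).symm (hP.ne_zero j) hQ (hP.homogeneous j) has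
      (hP.mul_mem_locIdeal ha hs))
  -- The degree `3 - deg C_j` of `s` gives `a s` the degree of the cofactor, which makes the first
  -- coefficient a constant.
  rw [Nat.sub_self] at hx
  obtain ⟨κ, rfl⟩ := exists_eq_C hx
  refine ⟨κ, t, ?_, e⟩
  rwa [show P.degree - 2 * (P.c j).totalDegree =
    P.degree - (P.c j).totalDegree - (P.c j).totalDegree by omega]

theorem grad_relation {a s Q t c : Poly} {κ : ℂ} {p : Pt} (h : a * s = C κ * Q + t * c)
    (hQ : VanishesAt Q p) (hc : VanishesAt c p) :
    eval p.rep a • grad s p + eval p.rep s • grad a p =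
      κ • grad Q p + eval p.rep t • grad c p := by
  have := congrArg (fun x => grad x p) h
  simpa only [grad_mul, grad_add, show eval p.rep Q = 0 from hQ, show eval p.rep c = 0 from hc,
    zero_smul, add_zero, grad_C_mul, eval_C, zero_add, ← C_mul'] using this

/-- The left side is singular at `p`, so the gradient of the relation is a linear dependence between
those of `Q` and `c`. -/
theorem coeff_eq_zero_of_transversalAt {a s Q t c : Poly} {κ : ℂ} {p : Pt}
    (h : a * s = C κ * Q + t * c) (ht : TransversalAt Q c p) (ha : VanishesAt a p)
    (hs : VanishesAt s p) : κ = 0 := by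
  have hg := grad_relation h ht.1 ht.2.1
  rw [show eval p.rep a = 0 from ha, show eval p.rep s = 0 from hs, zero_smul, zero_smul,
    add_zero] at hg
  exact (LinearIndependent.pair_iff.1 ht.2.2 _ _ hg.symm).1

/-- A nonzero adjoint contains no boundary component. -/
theorem IsPolycon.coeff_ne_zero (hP : P.IsPolycon) (hco : P.PairwiseCoprime)
    (hd : 3 ≤ P.degree) {a s t : Poly} {j : Fin n} {κ : ℂ} (ha0 : a ≠ 0)
    (hah : a.IsHomogeneous (P.degree - 3)) (ha : P.IsLocalAdjoint a) (hs : P.IsVertexForm j s)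
    (h : a * s = C κ * P.cofactor j + t * P.c j) : κ ≠ 0 := by
  rintro rfl
  have hdvd : ∀ {k : Fin n} {s t : Poly}, P.IsVertexForm k s →
      a * s = C 0 * P.cofactor k + t * P.c k → P.c k ∣ a := fun hs h => by
    rw [map_zero, zero_mul, zero_add] at h
    exact hs.coprime.symm.dvd_of_dvd_mul_right (Dvd.intro_left _ h.symm)
  -- At the vertex shared by `C_k` and `C_{k+1}` both `a` and the vertex form of `C_{k+1}` vanish,
  -- so the constant for `C_{k+1}` is zero as well.
  have hstep : ∀ k, P.c k ∣ a → P.c (k + 1) ∣ a := fun k hk => by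
    obtain ⟨s, hs⟩ := hP.exists_isVertexForm (k + 1)
    obtain ⟨κ, t, -, e⟩ := hP.exists_mul_eq hco hd hah ha hs
    have hx := hP.crossing k
    have hs' := hs.left
    rw [add_sub_cancel_right] at hs'
    obtain rfl := coeff_eq_zero_of_transversalAt e hx.symm.transversal_cofactor
      (vanishesAt_of_dvd hk hx.transversal.1) hs'
    exact hdvd hs e
  have hnat : ∀ m : ℕ, P.c (j + Fin.ofNat n m) ∣ a := fun m => by
    induction m with
    | zero => simpa using hdvd hs h
    | succ m ih =>
      have := hstep _ ih
      convert this using 2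
      rw [add_assoc]
      congr 1
      ext
      simp [Fin.val_add]
  have hall : ∀ k, P.c k ∣ a := fun k => by
    have := hnat (k - j).val
    rwa [Fin.ofNat_val_eq_self, add_sub_cancel] at this
  have hb : P.boundary ∣ a := Fintype.prod_dvd_of_isRelPrime (fun i k hik => hco i k hik) hall
  exact ha0 (eq_zero_of_dvd hah hP.isHomogeneous_boundary hb (by omega))

variable {a : Poly}

theorem IsPolycon.not_vanishesAt_vertex (hP : P.IsPolycon) (hco : P.PairwiseCoprime)
    (hd : 3 ≤ P.degree) (ha0 : a ≠ 0) (hah : a.IsHomogeneous (P.degree - 3))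
    (ha : P.IsLocalAdjoint a) (m : Fin n) : ¬ VanishesAt a (P.v m) := fun hv => by
  obtain ⟨s, hs⟩ := hP.exists_isVertexForm m
  obtain ⟨κ, t, -, e⟩ := hP.exists_mul_eq hco hd hah ha hs
  exact hP.coeff_ne_zero hco hd ha0 hah ha hs e (coeff_eq_zero_of_transversalAt e
    (hP.crossing m).transversal_cofactor hv hs.right)

/-- The adjoint is unique up to a factor. -/
theorem IsPolycon.exists_eq_C_mul (hP : P.IsPolycon) (hco : P.PairwiseCoprime)
    (hd : 3 ≤ P.degree) (ha0 : a ≠ 0) (hah : a.IsHomogeneous (P.degree - 3))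
    (ha : P.IsLocalAdjoint a) {b : Poly} (hbh : b.IsHomogeneous (P.degree - 3))
    (hb : P.IsLocalAdjoint b) : ∃ κ : ℂ, b = C κ * a := by
  have hv := hP.not_vanishesAt_vertex hco hd ha0 hah ha 0
  set v := (P.v 0).rep with hvdef
  refine ⟨eval v b / eval v a, ?_⟩
  -- The scalar makes `b - κ a` vanish at an explicit vertex, which no nonzero adjoint does.
  by_contra hne
  refine hP.not_vanishesAt_vertex hco hd (sub_ne_zero.2 hne) (hbh.sub (hah.C_mul _))
    (fun j p hp => sub_mem (hb j p hp) (Ideal.mul_mem_left _ _ (ha j p hp))) 0 ?_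
  rw [VanishesAt, ← hvdef, map_sub, map_mul, eval_C, div_mul_cancel₀ _ hv, sub_self]

theorem IsPolycon.isRelPrime_adjoint (hP : P.IsPolycon) (hco : P.PairwiseCoprime)
    (hd : 3 ≤ P.degree) (ha0 : a ≠ 0) (hah : a.IsHomogeneous (P.degree - 3))
    (ha : P.IsLocalAdjoint a) (j : Fin n) : IsRelPrime a (P.c j) := by
  obtain ⟨s, hs⟩ := hP.exists_isVertexForm j
  obtain ⟨κ, t, -, e⟩ := hP.exists_mul_eq hco hd hah ha hs
  have hκ := hP.coeff_ne_zero hco hd ha0 hah ha hs e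
  intro g hga hgc
  refine hco.cofactor j hgc ?_
  have h1 : g ∣ C κ * P.cofactor j :=
    (dvd_add_left (hgc.mul_left t)).1 (e ▸ hga.mul_right s)
  rwa [((isUnit_iff_ne_zero.2 hκ).map C).dvd_mul_left] at h1

/-- A common point of the adjoint and the boundary is residual. -/
theorem IsPolycon.mem_residual_of_vanishesAt (hP : P.IsPolycon) (hco : P.PairwiseCoprime)
    (hd : 3 ≤ P.degree) (ha0 : a ≠ 0) (hah : a.IsHomogeneous (P.degree - 3))
    (ha : P.IsLocalAdjoint a) {j : Fin n} {p : Pt} (hap : VanishesAt a p)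
    (hj : VanishesAt (P.c j) p) : p ∈ P.residual := by
  obtain ⟨s, hs⟩ := hP.exists_isVertexForm j
  obtain ⟨κ, t, -, e⟩ := hP.exists_mul_eq hco hd hah ha hs
  have hκ := hP.coeff_ne_zero hco hd ha0 hah ha hs e
  have hQ : VanishesAt (P.cofactor j) p := by
    have h1 := congrArg (eval p.rep) e
    simp only [map_mul, map_add, eval_C, show eval p.rep a = 0 from hap,
      show eval p.rep (P.c j) = 0 from hj, zero_mul, mul_zero, add_zero] at h1
    exact (mul_eq_zero.1 h1.symm).resolve_left hκ
  rcases hP.mem_residual_or hj hQ with h | ⟨m, rfl, -⟩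
  · exact h
  · exact absurd hap (hP.not_vanishesAt_vertex hco hd ha0 hah ha m)

/-- At a residual crossing, the adjoint is transversal to the branches. -/
theorem IsPolycon.transversal_adjoint (hP : P.IsPolycon) (hco : P.PairwiseCoprime)
    (hd : 3 ≤ P.degree) (ha0 : a ≠ 0) (hah : a.IsHomogeneous (P.degree - 3))
    (ha : P.IsLocalAdjoint a) {p : Pt} (hp : p ∈ P.residual) {j k : Fin n}
    (hx : P.Crossing p j k) {s : Poly} (hs : P.IsVertexForm j s) :
    TransversalAt a (P.c j) p ∧ ¬ VanishesAt s p := by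
  obtain ⟨κ, t, -, e⟩ := hP.exists_mul_eq hco hd hah ha hs
  have hκ := hP.coeff_ne_zero hco hd ha0 hah ha hs e
  have ht := hx.transversal_cofactor
  have hap : VanishesAt a p := by
    refine vanishesAt_of_mem_ptIdeal (locIdeal_le_ptIdeal (Ideal.span_le.2 ?_) (ha j p hp))
    rintro x (rfl | rfl)
    · exact (mem_ptIdeal_of_isHomogeneous (hP.isHomogeneous_cofactor j)).2 ht.1
    · exact hP.mem_ptIdeal.2 ht.2.1
  have hsp : ¬ VanishesAt s p := fun hsp =>
    hκ (coeff_eq_zero_of_transversalAt e ht hap hsp)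
  -- The relation becomes `s ∇a = κ ∇Q + t ∇c` at `p`; as `κ ≠ 0` and `∇Q`, `∇c` are independent, so
  -- are `∇a` and `∇c`.
  have hg := grad_relation e ht.1 ht.2.1
  rw [show eval p.rep a = 0 from hap, zero_smul, zero_add] at hg
  refine ⟨⟨hap, ht.2.1, ?_⟩, hsp⟩
  have hli := ht.2.2
  rw [LinearIndependent.pair_iff] at hli ⊢
  intro x y hxy
  have h1 := hli (x * κ) (x * eval p.rep t + y * eval p.rep s) (by
    have h2 : eval p.rep s • (x • grad a p + y • grad (P.c j) p) = 0 := by rw [hxy, smul_zero]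
    rw [smul_add, smul_comm, hg] at h2
    rw [← h2]
    module)
  have hx0 : x = 0 := (mul_eq_zero.1 h1.1).resolve_right hκ
  refine ⟨hx0, ?_⟩
  have h3 := h1.2
  rw [hx0, zero_mul, zero_add] at h3
  exact (mul_eq_zero.1 h3).resolve_right hsp

end PolyconData

namespace PlaneCurve

/-! ### Contact of order two along a set of points -/

/-- The curve `G = 0` meets `α = 0` exactly in the points of `S`, with multiplicity two, and both
are smooth branches there. -/
def TouchesAlong (α G : Poly) (S : Set Pt) : Prop :=
  ∀ p, (p ∉ S ∧ 1 ∈ locIdeal (Ideal.span {α, G}) p) ∨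
    (p ∈ S ∧ G ∈ locIdeal (Ideal.span {α} ⊔ ptIdeal p ^ 2) p ∧
      ptIdeal p ^ 2 ≤ locIdeal (Ideal.span {α, G}) p ∧ intMult α G p = 2)

theorem exists_isPointSum {S : Set Pt} (hS : S.Finite) : ∃ D, IsPointSum S D := by
  classical
  refine ⟨(Finsupp.indicator hS.toFinset fun _ _ => 1, 0), rfl, fun p => ?_⟩
  simp [Finsupp.indicator_apply, Set.indicator_apply]

theorem TouchesAlong.isIntersectionDivisor {α G : Poly} {S : Set Pt} (h : TouchesAlong α G S)
    {D : Divisor} (hD : IsPointSum S D) : IsIntersectionDivisor α G (2 • D) := by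
  refine ⟨by simp [hD.1], fun p => ?_⟩
  have e : (2 • D).1 p = 2 * S.indicator 1 p := by
    rw [← hD.2 p, Prod.smul_fst, Finsupp.smul_apply, nsmul_eq_mul]; rfl
  rcases h p with ⟨hp, h1⟩ | ⟨hp, -, -, h2⟩
  · rw [e, Set.indicator_of_notMem hp, intMult_eq_zero h1]
    simp
  · rw [e, Set.indicator_of_mem hp, h2]
    simp

theorem TouchesAlong.linEquiv {α G : Poly} {m : ℕ} {S : Set Pt} (h : TouchesAlong α G S)
    (hα0 : α ≠ 0) (hG : G.IsHomogeneous m) (hrel : IsRelPrime G α) {D D' : Divisor}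
    (hm : D'.2 - D.2 = m) (hD : ∀ p, D'.1 p - D.1 p = -2 * S.indicator 1 p) :
    LinEquiv α D D' := by
  refine linEquiv_of_form hα0 hG hrel hm fun p => ?_
  rcases h p with ⟨hp, h1⟩ | ⟨hp, h1, h2, -⟩
  · exact Or.inl ⟨by rw [hD, Set.indicator_of_notMem hp, mul_zero], h1⟩
  · exact Or.inr ⟨by rw [hD, Set.indicator_of_mem hp]; rfl, h1, h2⟩

end PlaneCurve

namespace PolyconData

variable {n : ℕ} {P : PolyconData n}

/-! ### Nodal polycons -/

theorem IsNodal.crossing (hn : P.IsNodal) {p : Pt} {j k : Fin n} (hjk : j ≠ k)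
    (hj : VanishesAt (P.c j) p) (hk : VanishesAt (P.c k) p) : P.Crossing p j k := by
  have hb : P.boundary = P.c j * P.c k * ∏ m ∈ (Finset.univ.erase j).erase k, P.c m := by
    rw [mul_assoc, Finset.mul_prod_erase _ _ (Finset.mem_erase.2 ⟨hjk.symm, Finset.mem_univ k⟩)]
    exact P.boundary_eq j
  have hs : p ∈ singularSet P.boundary := by
    rw [hb, mul_assoc]
    exact mem_singularSet_mul hj (vanishesAt_mul.2 (Or.inl hk))
  obtain ⟨h1, h2⟩ := (hb ▸ hn p hs).transversal hj hk
  refine ⟨hjk, h2, fun m hmj hmk hm => h1 (vanishesAt_prod.2 ⟨m, ?_, hm⟩)⟩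
  simp [hmj, hmk]

theorem IsNodal.exists_crossing (hn : P.IsNodal) {p : Pt} (hp : p ∈ P.residual) {j : Fin n}
    (hj : VanishesAt (P.c j) p) : ∃ k, P.Crossing p j k := by
  obtain ⟨k, hkj, hk⟩ := exists_ne_vanishesAt (vanishesAt_cofactor_of_mem_residual hp hj)
  exact ⟨k, hn.crossing hkj.symm hj hk⟩

theorem IsNodal.exists_crossing_of_mem_residual (hn : P.IsNodal) {p : Pt} (hp : p ∈ P.residual) :
    ∃ j k, P.Crossing p j k := by
  obtain ⟨j, k, hjk, hj, hk⟩ := exists_ne_vanishesAt_of_mem_residual hp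
  exact ⟨j, k, hn.crossing hjk hj hk⟩

variable [NeZero n]

theorem IsNodal.pairwiseCoprime (hn : P.IsNodal) (hP : P.IsPolycon) : P.PairwiseCoprime :=
  fun j k hjk => isRelPrime_of_forall_linearIndependent (hP.homogeneous j) (hP.homogeneous k)
    fun _ hj hk => (hn.crossing hjk hj hk).transversal.2.2

theorem IsNodal.finite_residual (hn : P.IsNodal) (hP : P.IsPolycon) : P.residual.Finite := by
  refine (Set.finite_iUnion fun j => Set.finite_iUnion fun k =>
    finite_setOf_transversalAt (hP.homogeneous j) (hP.homogeneous k)).subset fun p hp => ?_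
  obtain ⟨j, k, hx⟩ := hn.exists_crossing_of_mem_residual hp
  exact Set.mem_iUnion.2 ⟨j, Set.mem_iUnion.2 ⟨k, hx.transversal⟩⟩

/-- For nodal polycons, the adjoint condition is vanishing on the residual arrangement. -/
theorem IsNodal.isLocalAdjoint (hn : P.IsNodal) (hP : P.IsPolycon) {b : Poly}
    (hb : ∀ p ∈ P.residual, b ∈ ptIdeal p) : P.IsLocalAdjoint b := fun j p hp => by
  by_cases hj : VanishesAt (P.c j) p
  · obtain ⟨k, hx⟩ := hn.exists_crossing hp hj
    have ht := hx.transversal_cofactor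
    exact ptIdeal_le_locIdeal_of_transversalAt
      ((mem_ptIdeal_of_isHomogeneous (hP.isHomogeneous_cofactor j)).2 ht.1)
      (hP.mem_ptIdeal.2 hj) ht.2.2 (hb p hp)
  · exact mem_locIdeal_of_notMem (mt hP.mem_ptIdeal.1 hj) (Ideal.subset_span (by simp)) _

/-! ### The adjoint curve of a nodal polycon -/

/-- A nodal polycon with its adjoint. -/
structure NodalAdjoint (P : PolyconData n) (α : Poly) : Prop where
  polycon : P.IsPolycon
  nodal : P.IsNodal
  three_le : 3 ≤ P.degree
  ne_zero : α ≠ 0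
  homogeneous : α.IsHomogeneous (P.degree - 3)
  isLocalAdjoint : P.IsLocalAdjoint α

namespace NodalAdjoint

variable {α : Poly} (h : P.NodalAdjoint α)
include h

theorem pairwiseCoprime : P.PairwiseCoprime := h.nodal.pairwiseCoprime h.polycon

theorem transversal {p : Pt} (hp : p ∈ P.residual) {j k : Fin n} (hx : P.Crossing p j k) :
    TransversalAt α (P.c j) p := by
  obtain ⟨s, hs⟩ := h.polycon.exists_isVertexForm j
  exact (h.polycon.transversal_adjoint h.pairwiseCoprime h.three_le h.ne_zero h.homogeneous
    h.isLocalAdjoint hp hx hs).1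

theorem isSmoothPt {p : Pt} (hp : p ∈ P.residual) : IsSmoothPt α p := by
  obtain ⟨j, k, hx⟩ := h.nodal.exists_crossing_of_mem_residual hp
  have ht := h.transversal hp hx
  exact ⟨ht.1, ht.2.2.ne_zero 0⟩

theorem mem_ptIdeal {p : Pt} : α ∈ ptIdeal p ↔ VanishesAt α p :=
  mem_ptIdeal_of_isHomogeneous h.homogeneous

theorem mem_residual {j : Fin n} {p : Pt} (hα : VanishesAt α p) (hj : VanishesAt (P.c j) p) :
    p ∈ P.residual :=
  h.polycon.mem_residual_of_vanishesAt h.pairwiseCoprime h.three_le h.ne_zero h.homogeneous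
    h.isLocalAdjoint hα hj

theorem isRelPrime_component (j : Fin n) : IsRelPrime α (P.c j) :=
  h.polycon.isRelPrime_adjoint h.pairwiseCoprime h.three_le h.ne_zero h.homogeneous
    h.isLocalAdjoint j

theorem isRelPrime_prod (T : Finset (Fin n)) : IsRelPrime (∏ m ∈ T, P.c m) α :=
  IsRelPrime.prod_left fun j _ => (h.isRelPrime_component j).symm

/-- A form that agrees with a product of boundary components along the adjoint, up to a unit, has
contact of order two at a residual point. -/
theorem contact {p : Pt} (hp : p ∈ P.residual) {T : Finset (Fin n)}
    (hT : ∀ m, VanishesAt (P.c m) p → m ∈ T) {G w z : Poly} (hw : w ∉ ptIdeal p)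
    (hz : z ∉ ptIdeal p) {u : Poly} (e : w * G = z * (∏ m ∈ T, P.c m) + u * α) :
    G ∈ locIdeal (Ideal.span {α} ⊔ ptIdeal p ^ 2) p ∧
      ptIdeal p ^ 2 ≤ locIdeal (Ideal.span {α, G}) p ∧ intMult α G p = 2 := by
  obtain ⟨j, k, hx⟩ := h.nodal.exists_crossing_of_mem_residual hp
  have hj := hx.transversal.1
  have hk := hx.transversal.2.1
  have hj' := h.polycon.mem_ptIdeal.2 hj
  have hk' := h.polycon.mem_ptIdeal.2 hk
  obtain ⟨r, hr, hrp⟩ := hx.prod_eq (hT j hj) (hT k hk)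
  rw [hr] at e
  have htj := h.transversal hp hx
  have htk := h.transversal hp hx.symm
  have hr' : r ∉ ptIdeal p := fun hc => hrp (vanishesAt_of_mem_ptIdeal hc)
  have h2 : G ∈ locIdeal (Ideal.span {α} ⊔ ptIdeal p ^ 2) p := by
    refine mem_locIdeal.2 ⟨w, hw, ?_⟩
    rw [e]
    refine add_mem (Ideal.mem_sup_right (Ideal.mul_mem_left _ _ (Ideal.mul_mem_right _ _ ?_)))
      (Ideal.mem_sup_left (Ideal.mul_mem_left _ _ (Ideal.mem_span_singleton_self _)))
    rw [sq]
    exact Ideal.mul_mem_mul hj' hk'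
  have h1 : P.c j * P.c k ∈ locIdeal (Ideal.span {α, G}) p :=
    mem_locIdeal.2 ⟨z * r, mul_notMem_ptIdeal hz hr',
      Ideal.mem_span_pair.2 ⟨-u, w, by linear_combination e⟩⟩
  exact ⟨h2, sq_le_and_intMult_eq_two h.homogeneous (h.polycon.homogeneous j)
    (h.mem_ptIdeal.2 htj.1) hj' hk' htj.2.2 htk.2.2 h1 h2⟩

theorem touchesAlong_boundary : TouchesAlong α P.boundary P.residual := fun p => by
  by_cases hp : p ∈ P.residual
  · exact Or.inr ⟨hp, h.contact hp (T := Finset.univ) (fun m _ => Finset.mem_univ m)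
      (one_notMem_ptIdeal p) (one_notMem_ptIdeal p) (u := 0) (by rw [zero_mul, add_zero]; rfl)⟩
  · refine Or.inl ⟨hp, ?_⟩
    by_cases hα : VanishesAt α p
    · refine mem_locIdeal_of_notMem (u := P.boundary) ?_ (Ideal.subset_span (by simp)) _
      rw [mem_ptIdeal_of_isHomogeneous h.polycon.isHomogeneous_boundary]
      intro hb
      obtain ⟨j, -, hj⟩ := vanishesAt_prod.1 hb
      exact hp (h.mem_residual hα hj)
    · exact mem_locIdeal_of_notMem (mt h.mem_ptIdeal.1 hα) (Ideal.subset_span (by simp)) _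

/-- Along the adjoint, `G` is `Q_i / c_i` up to a scalar. Stated for any such `G`, so that it serves
both the form of degree `d - 4` from the vertex relation and the adjoint of the modified polycon. -/
theorem touchesAlong_of_mul_eq {i : Fin n} {G u : Poly} {m : ℕ} (hG : G.IsHomogeneous m) {κ : ℂ}
    (hκ : κ ≠ 0) (e : P.c i * G = C κ * P.cofactor i + u * α) :
    TouchesAlong α G {p ∈ P.residual | ¬ VanishesAt (P.c i) p} := fun p => by
  by_cases hα : VanishesAt α p
  swap
  · exact Or.inl ⟨fun hp => hα (h.isSmoothPt hp.1).1,
      mem_locIdeal_of_notMem (mt h.mem_ptIdeal.1 hα) (Ideal.subset_span (by simp)) _⟩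
  by_cases hi : VanishesAt (P.c i) p
  · refine Or.inl ⟨fun hp => hp.2 hi, mem_locIdeal_of_notMem (u := G) ?_
      (Ideal.subset_span (by simp)) _⟩
    rw [mem_ptIdeal_of_isHomogeneous hG]
    intro hGp
    -- At a residual point on `C_i` the cofactor has a simple zero along the adjoint, already
    -- accounted for by `c_i`. If `G` vanished too, the gradients of cofactor and adjoint would be
    -- dependent.
    have hp := h.mem_residual hα hi
    obtain ⟨k, hx⟩ := h.nodal.exists_crossing hp hi
    obtain ⟨r, hr, hrp⟩ := hx.cofactor_eq
    have ht := (h.transversal hp hx.symm).symm.mul_left hrp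
    rw [← hr] at ht
    have hg := grad_relation e ht.1 ht.2.1
    rw [show eval p.rep (P.c i) = 0 from hi, show eval p.rep G = 0 from hGp, zero_smul, zero_smul,
      add_zero] at hg
    exact hκ (LinearIndependent.pair_iff.1 ht.2.2 _ _ hg.symm).1
  · by_cases hp : p ∈ P.residual
    · exact Or.inr ⟨⟨hp, hi⟩, h.contact hp (T := Finset.univ.erase i)
        (fun m hm => Finset.mem_erase.2 ⟨by rintro rfl; exact hi hm, Finset.mem_univ m⟩)
        (mt h.polycon.mem_ptIdeal.1 hi) (z := C κ)
        (by rw [mem_ptIdeal_of_isHomogeneous (isHomogeneous_C _ _), VanishesAt, eval_C]; exact hκ)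
        e⟩
    · refine Or.inl ⟨fun hp' => hp hp'.1, mem_locIdeal_of_notMem (u := G) ?_
        (Ideal.subset_span (by simp)) _⟩
      rw [mem_ptIdeal_of_isHomogeneous hG]
      intro hGp
      have h1 := congrArg (eval p.rep) e
      simp only [map_mul, map_add, eval_C, show eval p.rep α = 0 from hα,
        show eval p.rep G = 0 from hGp, mul_zero, add_zero] at h1
      have hQ : VanishesAt (P.cofactor i) p := (mul_eq_zero.1 h1.symm).resolve_left hκ
      obtain ⟨k, -, hk⟩ := exists_ne_vanishesAt hQ
      exact hp (h.mem_residual hα hk)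

theorem isRelPrime_of_mul_eq {i : Fin n} {G u : Poly} {κ : ℂ}
    (hκ : κ ≠ 0) (e : P.c i * G = C κ * P.cofactor i + u * α) : IsRelPrime G α := by
  intro g hgG hgα
  refine h.isRelPrime_prod (Finset.univ.erase i) ?_ hgα
  have h1 : g ∣ C κ * P.cofactor i :=
    (dvd_add_left (hgα.mul_left u)).1 (e ▸ hgG.mul_left _)
  rwa [((isUnit_iff_ne_zero.2 hκ).map C).dvd_mul_left] at h1

/-- There are no sections with simple poles in residual points, if multiplication by boundary
components gives forms of the degree of the adjoint that vanish on the residual arrangement. -/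
theorem h0_eq_zero {S : Set Pt} {T : Finset (Fin n)}
    (hS : ∀ p ∈ S, p ∈ P.residual ∧ ∀ m, VanishesAt (P.c m) p → m ∈ T)
    (hT : ∀ p ∈ P.residual, ∃ m ∈ T, VanishesAt (P.c m) p) {E : Divisor}
    (hE : ∀ p, E.1 p = S.indicator 1 p)
    (hdeg : (P.degree : ℤ) - 3 = (∑ m ∈ T, (P.c m).totalDegree : ℕ) + E.2) : h0 α E = 0 := by
  refine h0_eq_zero_of_forall fun φ hφ => ?_
  have hQ : (∏ m ∈ T, P.c m).IsHomogeneous (∑ m ∈ T, (P.c m).totalDegree) :=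
    IsHomogeneous.prod _ _ _ fun m _ => h.polycon.homogeneous m
  -- At a point of `S` both branches occur in the product: one cancels the simple pole, the other
  -- makes the resulting form vanish.
  have hfac : ∀ p ∈ S, ∃ t t', ∏ m ∈ T, P.c m = t * t' ∧ t ∈ ptIdeal p ^ (E.1 p).toNat ∧
      t' ∈ ptIdeal p := fun p hp => by
    obtain ⟨hpR, hpT⟩ := hS p hp
    obtain ⟨j, k, hx⟩ := h.nodal.exists_crossing_of_mem_residual hpR
    obtain ⟨r, hr, -⟩ := hx.prod_eq (hpT j hx.transversal.1) (hpT k hx.transversal.2.1)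
    refine ⟨P.c j, P.c k * r, by rw [hr, mul_assoc], ?_,
      Ideal.mul_mem_right _ _ (h.polycon.mem_ptIdeal.2 hx.transversal.2.1)⟩
    rw [hE, Set.indicator_of_mem hp]
    simpa using h.polycon.mem_ptIdeal.2 hx.transversal.1
  have hone : ∀ p ∉ S, (1 : Poly) ∈ ptIdeal p ^ (E.1 p).toNat := fun p hp => by
    rw [hE, Set.indicator_of_notMem hp]
    simp
  have h3 := h.three_le
  obtain ⟨G, hG, hφG, hvan⟩ := exists_form_of_mem_globalSections h.homogeneous h.ne_zero hQ
    (N := P.degree - 3) (by omega) (fun p => by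
      by_cases hp : p ∈ S
      · obtain ⟨t, t', e, ht, -⟩ := hfac p hp
        exact ⟨t, t', e, ht⟩
      · exact ⟨1, _, (one_mul _).symm, hone p hp⟩) hφ
  have hGR : ∀ p ∈ P.residual, G ∈ ptIdeal p := fun p hp => by
    have hα := h.mem_ptIdeal.2 (h.isSmoothPt hp).1
    by_cases hpS : p ∈ S
    · obtain ⟨t, t', e, ht, ht'⟩ := hfac p hpS
      exact hvan p t t' e ht ht' hα
    · refine hvan p 1 _ (one_mul _).symm (hone p hpS) ?_ hα
      rw [mem_ptIdeal_of_isHomogeneous hQ]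
      exact vanishesAt_prod.2 (hT p hp)
  -- The form has the degree of an adjoint and vanishes on the residual arrangement, so it is a
  -- multiple of `α` and zero on the curve.
  obtain ⟨κ, rfl⟩ := h.polycon.exists_eq_C_mul h.pairwiseCoprime h.three_le h.ne_zero
    h.homogeneous h.isLocalAdjoint hG (h.nodal.isLocalAdjoint h.polycon hGR)
  rw [map_mul, toRat_self, mul_zero] at hφG
  exact (isUnit_toRat ((mk_mem_nonZeroDivisors_iff h.ne_zero).2
    (h.isRelPrime_prod T))).mul_left_eq_zero.1 hφG

end NodalAdjoint

end PolyconData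

namespace PolyconData

variable {n : ℕ} {P : PolyconData n}

/-! ### Replacing a boundary conic by a line -/

theorem replaceByLine_c_self (i : Fin n) (l : Poly) : (P.replaceByLine i l).c i = l :=
  Function.update_self _ _ _

theorem replaceByLine_c_of_ne {i j : Fin n} (hj : j ≠ i) (l : Poly) :
    (P.replaceByLine i l).c j = P.c j :=
  Function.update_of_ne hj _ _

theorem replaceByLine_cofactor (i : Fin n) (l : Poly) :
    (P.replaceByLine i l).cofactor i = P.cofactor i :=
  Finset.prod_congr rfl fun _ hk => replaceByLine_c_of_ne (Finset.ne_of_mem_erase hk) l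

theorem replaceByLine_degree {i : Fin n} {l : Poly} (hi : (P.c i).totalDegree = 2)
    (hl : l.totalDegree = 1) : (P.replaceByLine i l).degree + 1 = P.degree := by
  rw [degree_eq_add _ i, P.degree_eq_add i, replaceByLine_c_self, hl, hi]
  have : ∑ k ∈ Finset.univ.erase i, ((P.replaceByLine i l).c k).totalDegree =
      ∑ k ∈ Finset.univ.erase i, (P.c k).totalDegree :=
    Finset.sum_congr rfl fun k hk => by rw [replaceByLine_c_of_ne (Finset.ne_of_mem_erase hk)]
  omega

theorem cofactor_eq_mul {i j : Fin n} (hj : j ≠ i) :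
    P.cofactor j = P.c i * ∏ m ∈ (Finset.univ.erase j).erase i, P.c m :=
  (Finset.mul_prod_erase _ _ (Finset.mem_erase.2 ⟨hj.symm, Finset.mem_univ i⟩)).symm

theorem replaceByLine_cofactor_eq_mul {i j : Fin n} (hj : j ≠ i) (l : Poly) :
    (P.replaceByLine i l).cofactor j = l * ∏ m ∈ (Finset.univ.erase j).erase i, P.c m := by
  rw [cofactor_eq_mul hj, replaceByLine_c_self]
  congr 1
  exact Finset.prod_congr rfl fun _ hk => replaceByLine_c_of_ne (Finset.ne_of_mem_erase hk) l

variable [NeZero n]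

/-- A property that passes from each index to the next one, as long as `i` is avoided, and holds
for the index after `i`, holds for all indices except `i`. -/
theorem forall_ne_of_succ {i : Fin n} {p : Fin n → Prop} (h0 : p (i + 1))
    (hs : ∀ k, k ≠ i → k + 1 ≠ i → p k → p (k + 1)) : ∀ j, j ≠ i → p j := by
  -- The walk `i + 1, …, i + (n - 1)` does not return to `i`; the remaining offset `n - 1` from `i +
  -- 1` is `i` itself.
  have hne : ∀ m : ℕ, m + 1 < n → i + 1 + Fin.ofNat n m ≠ i := fun m hm he => by
    rw [add_assoc, add_eq_left, Fin.ext_iff, Fin.val_add, Fin.val_one', Fin.val_ofNat,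
      ← Nat.add_mod, Fin.val_zero, Nat.mod_eq_of_lt (by omega)] at he
    omega
  have hstep : ∀ m : ℕ, i + 1 + Fin.ofNat n (m + 1) = i + 1 + Fin.ofNat n m + 1 := fun m => by
    rw [add_assoc _ _ (1 : Fin n)]
    congr 1
    ext
    simp [Fin.val_add]
  have hm : ∀ m : ℕ, m + 1 < n → p (i + 1 + Fin.ofNat n m) := fun m => by
    induction m with
    | zero => intro _; simpa using h0
    | succ m ih =>
      intro hm
      rw [hstep]
      exact hs _ (hne m (by omega)) (by rw [← hstep]; exact hne _ hm) (ih (by omega))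
  intro j hj
  have hv : Fin.ofNat n (j - (i + 1)).val = j - (i + 1) := Fin.ofNat_val_eq_self _
  rcases Nat.lt_or_ge ((j - (i + 1)).val + 1) n with hlt | hge
  · have := hm _ hlt
    rwa [hv, add_sub_cancel] at this
  · exfalso
    apply hj
    have h1 : (j - (i + 1)) + 1 = 0 := by
      ext
      have := (j - (i + 1)).isLt
      rw [Fin.val_add, Fin.val_one', Nat.add_mod_mod,
        show (j - (i + 1)).val + 1 = n by omega, Nat.mod_self, Fin.val_zero]
    rw [← sub_sub, sub_add_cancel] at h1
    exact sub_eq_zero.1 h1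

/-- A polycon obtained by replacing a component by a line has pairwise coprime components. -/
theorem IsPolycon.pairwiseCoprime_replaceByLine (hP : P.IsPolycon) (hco : P.PairwiseCoprime)
    {i : Fin n} {l : Poly} (hl : l.IsHomogeneous 1) (hl0 : l ≠ 0)
    (h1 : VanishesAt l (P.v (i - 1))) (h2 : VanishesAt l (P.v i))
    (hP' : (P.replaceByLine i l).IsPolycon) : (P.replaceByLine i l).PairwiseCoprime := by
  have key : ∀ j, j ≠ i → IsRelPrime l (P.c j) := fun j hj => by
    rw [(irreducible_of_isHomogeneous_one hl hl0).isRelPrime_iff_not_dvd]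
    intro hd
    obtain rfl : j = i + 1 := by
      by_contra hj1
      exact hP.other i j hj hj1 (vanishesAt_of_dvd hd h2)
    -- The new arrangement need not be nodal. If `l` divided a component, this would be `C_{i+1}`,
    -- tangent to or singular along `l` at `v i`, against transversality there.
    have ht := (hP'.transversal i).2.2
    rw [replaceByLine_c_self, replaceByLine_c_of_ne hj] at ht
    obtain ⟨m, hm⟩ := hd
    rw [hm] at ht
    change LinearIndependent ℂ ![grad l (P.v i), grad (l * m) (P.v i)] at ht
    rw [grad_mul, show eval (P.v i).rep l = 0 from h2, zero_smul, zero_add,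
      LinearIndependent.pair_iff] at ht
    have := (ht (eval (P.v i).rep m) (-1) (by module)).2
    norm_num at this
  intro j k hjk
  by_cases hj : j = i
  · subst hj
    rw [replaceByLine_c_self, replaceByLine_c_of_ne hjk.symm]
    exact key k hjk.symm
  · rw [replaceByLine_c_of_ne hj]
    by_cases hk : k = i
    · subst hk
      rw [replaceByLine_c_self]
      exact (key j hj).symm
    · rw [replaceByLine_c_of_ne hk]
      exact hco j k hjk

theorem IsPolycon.isVertexForm_line (hP : P.IsPolycon) {i : Fin n} {l : Poly}
    (hi : (P.c i).totalDegree = 2) (hl : l.IsHomogeneous 1) (hl0 : l ≠ 0)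
    (h1 : VanishesAt l (P.v (i - 1))) (h2 : VanishesAt l (P.v i)) : P.IsVertexForm i l := by
  refine ⟨by rw [hi]; exact hl, h1, h2, ?_⟩
  rw [(irreducible_of_isHomogeneous_one hl hl0).isRelPrime_iff_not_dvd]
  exact fun hd => hP.split i hi l hl hd ⟨h1, h2⟩

namespace NodalAdjoint

variable {α : Poly} (h : P.NodalAdjoint α)
include h

/-- The common residual points before and after the replacement are those not on the conic. -/
theorem residual_inter_replaceByLine {i : Fin n} {l : Poly} (hl : l.IsHomogeneous 1) (hl0 : l ≠ 0)
    (hs : P.IsVertexForm i l) : P.residual ∩ (P.replaceByLine i l).residual =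
      {p ∈ P.residual | ¬ VanishesAt (P.c i) p} := by
  ext p
  refine and_congr_right fun hp => ⟨fun hp' hi => ?_, fun hi => ?_⟩
  · obtain ⟨k, hx⟩ := h.nodal.exists_crossing hp hi
    -- At a residual point on the conic, `l` is nonzero and the cofactor is smooth, so the new
    -- boundary is smooth there.
    have hlp := (h.polycon.transversal_adjoint h.pairwiseCoprime h.three_le h.ne_zero h.homogeneous
      h.isLocalAdjoint hp hx hs).2
    have ht := hx.transversal_cofactor
    have hg := hp'.1.2
    rw [boundary_eq _ i, replaceByLine_c_self, replaceByLine_cofactor, grad_mul,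
      show eval p.rep (P.cofactor i) = 0 from ht.1, zero_smul, add_zero, smul_eq_zero] at hg
    exact ht.2.2.ne_zero 0 (hg.resolve_left hlp)
  · obtain ⟨j, k, hx⟩ := h.nodal.exists_crossing_of_mem_residual hp
    have hj : j ≠ i := by rintro rfl; exact hi hx.transversal.1
    have hk : k ≠ i := by rintro rfl; exact hi hx.transversal.2.1
    obtain ⟨-, hv, hsing⟩ := mem_residual_iff.1 hp
    refine mem_residual_iff.2 ⟨?_, hv, fun m hm => ?_⟩
    · rw [boundary_eq _ j]
      refine mem_singularSet_mul ?_ (vanishesAt_prod.2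
        ⟨k, Finset.mem_erase.2 ⟨hx.ne.symm, Finset.mem_univ k⟩, ?_⟩)
      · rw [replaceByLine_c_of_ne hj]; exact hx.transversal.1
      · rw [replaceByLine_c_of_ne hk]; exact hx.transversal.2.1
    · by_cases hmi : m = i
      · subst hmi
        rw [replaceByLine_c_self] at hm
        exact grad_ne_zero_of_isHomogeneous_one hl hl0 p hm.2
      · rw [replaceByLine_c_of_ne hmi] at hm
        exact hsing m hm

/-- On every other component, the adjoints before and after the replacement are related. -/
theorem exists_dvd_sub {i : Fin n} {l : Poly} (hP' : (P.replaceByLine i l).IsPolycon)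
    (hco' : (P.replaceByLine i l).PairwiseCoprime) (hd' : 3 ≤ (P.replaceByLine i l).degree)
    {β : Poly} (hβ0 : β ≠ 0) (hβh : β.IsHomogeneous ((P.replaceByLine i l).degree - 3))
    (hβ : (P.replaceByLine i l).IsLocalAdjoint β) {j : Fin n} (hj : j ≠ i) :
    ∃ μ : ℂ, μ ≠ 0 ∧ P.c j ∣ l * α - C μ * (P.c i * β) := by
  obtain ⟨s, hs⟩ := h.polycon.exists_isVertexForm j
  have hs' : (P.replaceByLine i l).IsVertexForm j s := by
    have e := replaceByLine_c_of_ne (P := P) hj l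
    exact ⟨by rw [e]; exact hs.homogeneous, hs.left, hs.right, by rw [e]; exact hs.coprime⟩
  obtain ⟨κ, t, -, e⟩ := h.polycon.exists_mul_eq h.pairwiseCoprime h.three_le h.homogeneous
    h.isLocalAdjoint hs
  obtain ⟨κ', t', -, e'⟩ := hP'.exists_mul_eq hco' hd' hβh hβ hs'
  have hκ := h.polycon.coeff_ne_zero h.pairwiseCoprime h.three_le h.ne_zero h.homogeneous
    h.isLocalAdjoint hs e
  have hκ' := hP'.coeff_ne_zero hco' hd' hβ0 hβh hβ hs' e'
  rw [cofactor_eq_mul hj] at e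
  rw [replaceByLine_cofactor_eq_mul hj, replaceByLine_c_of_ne hj] at e'
  -- Modulo `c_j`, with `M` the product of the components other than `C_j` and `C_i`, `α s` is `κ
  -- c_i M` and `β s` is `κ' l M`. Eliminating `M` and cancelling `s`, which is coprime to `c_j`,
  -- gives the constant `κ / κ'`.
  refine ⟨κ / κ', div_ne_zero hκ hκ', hs.coprime.symm.dvd_of_dvd_mul_left
    ⟨l * t - C (κ / κ') * P.c i * t', ?_⟩⟩
  have hC : C (κ / κ') * C κ' = (C κ : Poly) := by rw [← C_mul, div_mul_cancel₀ _ hκ']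
  linear_combination l * e - C (κ / κ') * P.c i * e' -
    l * P.c i * (∏ m ∈ (Finset.univ.erase j).erase i, P.c m) * hC

/-- The adjoint after the replacement cuts out the same divisor as the product of the other
components divided by the conic. -/
theorem exists_mul_adjoint_eq {i : Fin n} {l : Poly} (hi : (P.c i).totalDegree = 2)
    (hd : 4 ≤ P.degree) (hl : l.IsHomogeneous 1) (hl0 : l ≠ 0) (hs : P.IsVertexForm i l)
    (hP' : (P.replaceByLine i l).IsPolycon) {β : Poly}
    (hβ : (P.replaceByLine i l).IsAdjoint β) :
    ∃ (κ : ℂ) (u : Poly), κ ≠ 0 ∧ P.c i * β = C κ * P.cofactor i + u * α := by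
  have hco' := h.polycon.pairwiseCoprime_replaceByLine h.pairwiseCoprime hl hl0 hs.left hs.right hP'
  have hdeg := replaceByLine_degree hi (hl.totalDegree hl0)
  have hloc := hP'.isLocalAdjoint hco' hβ
  have hrel : ∀ {j : Fin n}, j ≠ i → ∃ μ : ℂ, μ ≠ 0 ∧ P.c j ∣ l * α - C μ * (P.c i * β) := fun hj =>
    h.exists_dvd_sub hP' hco' (by omega) hβ.1 hβ.2.1 hloc hj
  obtain ⟨μ, hμ, h1⟩ := hrel (h.polycon.add_one_ne i)
  have hall : ∀ j, j ≠ i → P.c j ∣ l * α - C μ * (P.c i * β) := by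
    -- The constants of neighbouring components agree: at their common vertex both relations hold,
    -- and `l α` is nonzero there.
    refine forall_ne_of_succ h1 fun k hk hk1 hdvd => ?_
    obtain ⟨μ', -, h2⟩ := hrel hk1
    have hx := h.polycon.crossing k
    have e1 := vanishesAt_of_dvd hdvd hx.transversal.1
    have e2 := vanishesAt_of_dvd h2 hx.transversal.2.1
    have hlk : ¬ VanishesAt l (P.v k) := by
      have := hP'.other k i hk.symm hk1.symm
      rwa [replaceByLine_c_self] at this
    have hαk := h.polycon.not_vanishesAt_vertex h.pairwiseCoprime h.three_le h.ne_zero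
      h.homogeneous h.isLocalAdjoint k
    have hne := mul_ne_zero hlk hαk
    simp only [VanishesAt, map_sub, map_mul, eval_C] at e1 e2
    have hz : eval (P.v k).rep (P.c i) * eval (P.v k).rep β ≠ 0 := fun h0 => by
      rw [h0, mul_zero, sub_zero] at e1
      exact hne e1
    obtain rfl : μ = μ' := mul_right_cancel₀ hz (by linear_combination e2 - e1)
    exact h2
  have hQ : P.cofactor i ∣ l * α - C μ * (P.c i * β) :=
    Finset.prod_dvd_of_isRelPrime (fun j _ k _ hjk => h.pairwiseCoprime j k hjk)
      fun j hj => hall j (Finset.ne_of_mem_erase hj)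
  have hhom : (l * α - C μ * (P.c i * β)).IsHomogeneous (P.degree - (P.c i).totalDegree) := by
    refine IsHomogeneous.sub ?_ (IsHomogeneous.C_mul ?_ _)
    · have := hl.mul h.homogeneous
      rwa [show 1 + (P.degree - 3) = P.degree - (P.c i).totalDegree by omega] at this
    · have := (h.polycon.homogeneous i).mul hβ.2.1
      rwa [show (P.c i).totalDegree + ((P.replaceByLine i l).degree - 3) =
        P.degree - (P.c i).totalDegree by omega] at this
  obtain ⟨ν, hν⟩ := PlaneCurve.exists_eq_C_mul hhom (h.polycon.isHomogeneous_cofactor i) hQ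
  -- Otherwise the conic would divide `l α`, although it is coprime to both factors.
  have hν0 : ν ≠ 0 := by
    rintro rfl
    rw [map_zero, zero_mul, sub_eq_zero] at hν
    have hu : IsUnit (P.c i) := by
      refine (IsRelPrime.mul_left hs.coprime (h.isRelPrime_component i)) ?_ dvd_rfl
      rw [hν]
      exact Dvd.intro _ (mul_left_comm _ _ _)
    have hu' := hu.map (eval (P.v i).rep)
    exact hu'.ne_zero (h.polycon.transversal i).1
  have hC : (C μ⁻¹ * C μ : Poly) = 1 := by rw [← C_mul, inv_mul_cancel₀ hμ, C_1]
  refine ⟨-(μ⁻¹ * ν), C μ⁻¹ * l, neg_ne_zero.2 (mul_ne_zero (inv_ne_zero hμ) hν0), ?_⟩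
  rw [C_neg, C_mul]
  linear_combination -C μ⁻¹ * hν - P.c i * β * hC

end NodalAdjoint

end PolyconData

/-! ### The contact divisor and the residual divisor -/

open PolyconData

theorem mainTheorem7 {n : ℕ} [NeZero n] (P : PolyconData n) (hP : P.IsPolycon)
    (hnodal : P.IsNodal) (hdeg : 4 ≤ P.degree)
    (α : PlaneCurve.Poly) (hα : P.IsAdjoint α) :
    (∀ (i : Fin n) (l : PlaneCurve.Poly), (P.c i).totalDegree = 2 →
      l ≠ 0 → l.IsHomogeneous 1 →
      PlaneCurve.VanishesAt l (P.v (i - 1)) → PlaneCurve.VanishesAt l (P.v i) →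
      ∃ D : PlaneCurve.Divisor,
        PlaneCurve.IsPointSum (P.residual ∩ (P.replaceByLine i l).residual) D ∧
        PlaneCurve.SupportedInRegularLocus α D ∧
        ((P.replaceByLine i l).IsPolycon →
          ∀ α' : PlaneCurve.Poly, (P.replaceByLine i l).IsAdjoint α' →
            PlaneCurve.IsIntersectionDivisor α α' (2 • D)) ∧
        PlaneCurve.LinEquiv α (2 • D) (((P.degree : ℤ) - 4) • PlaneCurve.H) ∧
        PlaneCurve.h0 α (D - PlaneCurve.H) = 0 ∧
        PlaneCurve.DixonHypotheses α (P.degree - 3) D) ∧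
    (∃ R : PlaneCurve.Divisor,
      PlaneCurve.IsPointSum P.residual R ∧
      PlaneCurve.SupportedInRegularLocus α R ∧
      PlaneCurve.LinEquiv α (2 • (R - 3 • PlaneCurve.H)) (((P.degree : ℤ) - 6) • PlaneCurve.H) ∧
      PlaneCurve.h0 α (R - 3 • PlaneCurve.H) = 0) := by
  have h : P.NodalAdjoint α := ⟨hP, hnodal, by omega, hα.1, hα.2.1,
    hP.isLocalAdjoint (hnodal.pairwiseCoprime hP) hα⟩
  have hfin := hnodal.finite_residual hP
  have hreg : ∀ {S : Set Pt} {D : Divisor}, IsPointSum S D → S ⊆ P.residual →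
      SupportedInRegularLocus α D := fun hD hS p hp => by
    refine h.isSmoothPt (hS ?_)
    rw [hD.2] at hp
    exact Set.mem_of_indicator_ne_zero hp
  constructor
  · intro i l hi hl0 hl h1 h2
    have hs := hP.isVertexForm_line hi hl hl0 h1 h2
    rw [h.residual_inter_replaceByLine hl hl0 hs]
    set S := {p ∈ P.residual | ¬ VanishesAt (P.c i) p} with hS
    have hSR : S ⊆ P.residual := fun p hp => hp.1
    obtain ⟨D, hD⟩ := exists_isPointSum (hfin.subset hSR)
    obtain ⟨κ, G, hG, e⟩ := hP.exists_mul_eq h.pairwiseCoprime h.three_le h.homogeneous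
      h.isLocalAdjoint hs
    have hκ := hP.coeff_ne_zero h.pairwiseCoprime h.three_le h.ne_zero h.homogeneous
      h.isLocalAdjoint hs e
    rw [hi] at hG
    -- With `s = l` the cofactor of the conic in the vertex relation is the required contact curve,
    -- of degree `d - 4`; it exists even if `P'` is not a polycon.
    have e' : P.c i * G = C (-κ) * P.cofactor i + l * α := by
      rw [C_neg]
      linear_combination -e
    have hκ' := neg_ne_zero.2 hκ
    have hT := h.touchesAlong_of_mul_eq hG hκ' e'
    have hdegi := P.degree_eq_add i
    have h0 : h0 α (D - H) = 0 := by
      -- Multiplication by the cofactor of `C_i`, of degree `d - 2`, takes the twist `-1` to `d -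
      -- 3`. Every residual point lies on a component other than `C_i`.
      refine h.h0_eq_zero (S := S) (T := Finset.univ.erase i) (fun p hp => ⟨hp.1, fun m hm =>
        Finset.mem_erase.2 ⟨?_, Finset.mem_univ m⟩⟩) (fun p hp => ?_) (fun p => ?_) ?_
      · rintro rfl
        exact hp.2 hm
      · obtain ⟨j, k, hx⟩ := hnodal.exists_crossing_of_mem_residual hp
        by_cases hj : j = i
        · exact ⟨k, Finset.mem_erase.2 ⟨hj ▸ hx.ne.symm, Finset.mem_univ k⟩, hx.transversal.2.1⟩
        · exact ⟨j, Finset.mem_erase.2 ⟨hj, Finset.mem_univ j⟩, hx.transversal.1⟩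
      · rw [← hD.2 p]
        simp [H]
      · rw [Prod.snd_sub, hD.1, H]
        omega
    refine ⟨D, hD, hreg hD hSR, fun hP' α' hα' => ?_, ?_, h0, hα.1, hα.2.1, by omega,
      hreg hD hSR, ⟨G, ?_, hT.isIntersectionDivisor hD⟩, h0⟩
    · obtain ⟨κ₁, u, hκ₁, e₁⟩ := h.exists_mul_adjoint_eq hi hdeg hl hl0 hs hP' hα'
      exact (h.touchesAlong_of_mul_eq hα'.2.1 hκ₁ e₁).isIntersectionDivisor hD
    · refine hT.linEquiv hα.1 hG (h.isRelPrime_of_mul_eq hκ' e') ?_ fun p => ?_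
      · simp [hD.1, H]
        omega
      · rw [← hD.2 p]
        simp [H]
    · convert hG using 1
      omega
  · obtain ⟨R, hR⟩ := exists_isPointSum hfin
    refine ⟨R, hR, hreg hR subset_rfl, ?_, ?_⟩
    -- The boundary itself, of degree `d`, cuts out `2R`; subtracting `6H` on both sides gives the
    -- claim.
    · refine h.touchesAlong_boundary.linEquiv hα.1 hP.isHomogeneous_boundary
        (h.isRelPrime_prod Finset.univ) ?_ fun p => ?_
      · simp [hR.1, H]
      · rw [← hR.2 p]
        simp [H]
    · refine h.h0_eq_zero (S := P.residual) (T := Finset.univ)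
        (fun p hp => ⟨hp, fun m _ => Finset.mem_univ m⟩) (fun p hp => ?_) (fun p => ?_) ?_
      · obtain ⟨j, k, hx⟩ := hnodal.exists_crossing_of_mem_residual hp
        exact ⟨j, Finset.mem_univ j, hx.transversal.1⟩
      · rw [← hR.2 p]
        simp [H]
      · simp [hR.1, H, degree]
        ring

end
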